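/- **Conventions.** Let $R$ be the ring of integers of a number field $K$, let $n\ge 1$, and let $I$ be a nonzero ideal of $R$. Write $M_n(R)^\times$ for the monoid of left regular elements of $M_n(R)$ (those $a$ for which $x\mapsto ax$ is injective). It acts by left multiplication on the additive group $A=M_n(I)\subseteq M_n(R)$ of matrices with entries in $I$; write $\sigma_s(a)=sa$. Let $\mathcal C$ be the smallest family of subgroups of $A$ that contains $A$ and contains $\sigma_s(C)$ and $\sigma_s^{-1}(C)$ whenever it contains $C$, for $s\in M_n(R)^\times$. Let $\overline{A}=\varprojlim_{C\in\mathcal C}A/C$, with the inverse limit topology, each $A/C$ being discrete. The discrete group $M_n(K)\rtimes \mathrm{GL}_n(K)$ acts on $M_n(K)$ by affine maps $(z,\gamma).x=z+\gamma x$. Restricting to $A\subseteq M_n(K)$, each $g$ in this group gives a partial bijection $\{a\in A : g.a\in A\}\to A$, $a\mapsto g.a$. These extend uniquely by continuity to a partial action of $M_n(K)\rtimes\mathrm{GL}_n(K)$ on $\overline{A}$ by homeomorphisms $x\mapsto g.x$ between open subsets, the graph of the extension of $g$ being the closure of the graph of the partial bijection. Let $$\mathcal G_{K,n,I}=(M_n(K)\rtimes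 \mathrm{GL}_n(K))\ltimes\overline{M_n(I)}$$ be the associated transformation groupoid. It consists of the pairs $(g,x)$ with $x\in\overline{A}$ in the domain of $g$, with source $x$, range $g.x$ and product $(h,g.x)(g,x)=(hg,x)$, and it carries the subspace topology of $(M_n(K)\rtimes \mathrm{GL}_n(K))\times\overline{A}$. It is the groupoid of the multiplication action $M_n(R)^\times\curvearrowright M_n(I)$. Write $\mathcal G_{K,n}=\mathcal G_{K,n,R}$ for the groupoid of $M_n(R)^\times\curvearrowright M_n(R)$. **Statement.** For $i=1,2$, let $K_i$ be a number field with ring of integers $R_i$, and let $n_i\ge 1$ be an integer. 1. The topological groupoids $\mathcal G_{K_1,n_1}$ and $\mathcal G_{K_2,n_2}$ are isomorphic if and only if $n_1=n_2$ and $K_1\cong K_2$ as fields. 2. If $I_1\subseteq R_1$ and $I_2\subseteq R_2$ are nonzero ideals and the topological groupoids $\mathcal G_{K_1,n_1,I_1}$ and $\mathcal G_{K_2,n_2,I_2}$ are isomorphic, then $M_{n_1}(K_1)$ and $M_{n_2}(K_2)$ are isomorphic as $\mathbb Q$-algebras. -/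

import Mathlib

open Topology

set_option linter.checkUnivs false

universe u v w x

/-! ### Topological groupoids -/

/-- A topological groupoid: spaces of objects (units) and arrows, with continuous source, target,
identity, inversion and (partially defined) composition maps. `comp p q h` is the product `p q`,
i.e. first `q`, then `p`. -/
structure TopGroupoid : Type (max (u + 1) (v + 1)) where
  Obj : Type u
  Arr : Type v
  [topObj : TopologicalSpace Obj]
  [topArr : TopologicalSpace Arr]
  src : Arr → Obj
  tgt : Arr → Obj
  one : Obj → Arr
  inv : Arr → Arr
  comp : (p q : Arr) → src p = tgt q → Arr
  src_one : ∀ x, src (one x) = x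
  tgt_one : ∀ x, tgt (one x) = x
  src_comp : ∀ p q h, src (comp p q h) = src q
  tgt_comp : ∀ p q h, tgt (comp p q h) = tgt p
  comp_assoc : ∀ p q r (h : src p = tgt q) (h' : src q = tgt r),
    comp (comp p q h) r ((src_comp p q h).trans h') =
      comp p (comp q r h') (h.trans (tgt_comp q r h').symm)
  one_comp : ∀ p, comp (one (tgt p)) p (src_one (tgt p)) = p
  comp_one : ∀ p, comp p (one (src p)) (tgt_one (src p)).symm = p
  src_inv : ∀ p, src (inv p) = tgt p
  tgt_inv : ∀ p, tgt (inv p) = src p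
  inv_comp : ∀ p, comp (inv p) p (src_inv p) = one (src p)
  comp_inv : ∀ p, comp p (inv p) (tgt_inv p).symm = one (tgt p)
  continuous_src : Continuous src
  continuous_tgt : Continuous tgt
  continuous_one : Continuous one
  continuous_inv : Continuous inv
  continuous_comp : Continuous fun z : {z : Arr × Arr // src z.1 = tgt z.2} =>
    comp z.1.1 z.1.2 z.2

attribute [instance] TopGroupoid.topObj TopGroupoid.topArr

/-- An isomorphism of topological groupoids: homeomorphisms of the object and arrow spaces that
respect source, target and composition (hence also identities and inverses). -/
structure TopGroupoid.Iso (G : TopGroupoid.{u, v}) (H : TopGroupoid.{w, x}) where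
  obj : G.Obj ≃ₜ H.Obj
  arr : G.Arr ≃ₜ H.Arr
  map_src : ∀ p, H.src (arr p) = obj (G.src p)
  map_tgt : ∀ p, H.tgt (arr p) = obj (G.tgt p)
  map_comp : ∀ p q (h : G.src p = G.tgt q),
    arr (G.comp p q h) = H.comp (arr p) (arr q) (by rw [map_src, map_tgt, h])

/-! ### Partial actions and their transformation groupoids -/

/-- A partial action of a (discrete) group `G` on a space `X` by partial homeomorphisms between
open subsets. -/
structure TopPartialAction (G : Type u) [Group G] (X : Type v) [TopologicalSpace X] where
  toHomeo : G → OpenPartialHomeomorph X X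
  source_one : (toHomeo 1).source = Set.univ
  apply_one : ∀ x, toHomeo 1 x = x
  source_inv : ∀ g, (toHomeo g⁻¹).source = (toHomeo g).target
  apply_inv_apply : ∀ g x, x ∈ (toHomeo g).source → toHomeo g⁻¹ (toHomeo g x) = x
  mem_source_mul : ∀ h g x, x ∈ (toHomeo g).source → toHomeo g x ∈ (toHomeo h).source →
    x ∈ (toHomeo (h * g)).source
  apply_mul : ∀ h g x, x ∈ (toHomeo g).source → toHomeo g x ∈ (toHomeo h).source →
    toHomeo (h * g) x = toHomeo h (toHomeo g x)

namespace TopPartialAction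

variable {G : Type u} [Group G] {X : Type v} [TopologicalSpace X] (θ : TopPartialAction G X)

/-- The arrows of `G ⋉ X`: pairs `(g, x)` with `x` in the domain of `g`. -/
def Arrow : Type (max u v) := {p : G × X // p.2 ∈ (θ.toHomeo p.1).source}

/-- The arrow space carries the subspace topology of `G × X`, where `G` is discrete. -/
instance : TopologicalSpace θ.Arrow :=
  @instTopologicalSpaceSubtype (G × X) _ (@instTopologicalSpaceProd G X ⊥ _)

theorem continuous_tgt_aux : Continuous fun p : θ.Arrow => θ.toHomeo p.1.1 p.1.2 := by
  let : TopologicalSpace G := ⊥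
  have : DiscreteTopology G := discreteTopology_bot G
  have h1 : Continuous fun p : θ.Arrow => p.1 := continuous_subtype_val
  rw [continuous_iff_continuousAt]
  intro p
  have hg : ∀ᶠ q : θ.Arrow in 𝓝 p, q.1.1 = p.1.1 :=
    (continuous_fst.comp h1).continuousAt.preimage_mem_nhds
      ((isOpen_discrete {p.1.1}).mem_nhds rfl)
  have hc : ContinuousAt (fun q : θ.Arrow => θ.toHomeo p.1.1 q.1.2) p :=
    ContinuousAt.comp (f := fun q : θ.Arrow => q.1.2) ((θ.toHomeo p.1.1).continuousAt p.2)
      (continuous_snd.comp h1).continuousAt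
  exact hc.congr (hg.mono fun q hq => by simp only [hq])

/-- The transformation groupoid `G ⋉ X` of a partial action: the arrow `(g, x)` has source `x` and
target `g.x`, and `(h, g.x) (g, x) = (h g, x)`. -/
def groupoid : TopGroupoid.{v, max u v} where
  Obj := X
  Arr := θ.Arrow
  src p := p.1.2
  tgt p := θ.toHomeo p.1.1 p.1.2
  one x := ⟨(1, x), by rw [θ.source_one]; trivial⟩
  inv p := ⟨(p.1.1⁻¹, θ.toHomeo p.1.1 p.1.2), by
    rw [θ.source_inv]; exact (θ.toHomeo p.1.1).map_source p.2⟩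
  comp p q h := ⟨(p.1.1 * q.1.1, q.1.2), θ.mem_source_mul _ _ _ q.2 (h ▸ p.2)⟩
  src_one _ := rfl
  tgt_one x := θ.apply_one x
  src_comp _ _ _ := rfl
  tgt_comp p q h := by
    change θ.toHomeo (p.1.1 * q.1.1) q.1.2 = _
    rw [θ.apply_mul _ _ _ q.2 (h ▸ p.2), h]
  comp_assoc p q r _ _ := Subtype.ext (Prod.ext (mul_assoc _ _ _) rfl)
  one_comp p := Subtype.ext (Prod.ext (one_mul _) rfl)
  comp_one p := Subtype.ext (Prod.ext (mul_one _) rfl)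
  src_inv _ := rfl
  tgt_inv p := θ.apply_inv_apply _ _ p.2
  inv_comp p := Subtype.ext (Prod.ext (inv_mul_cancel _) rfl)
  comp_inv p := Subtype.ext (Prod.ext (mul_inv_cancel _) rfl)
  continuous_src := by
    let : TopologicalSpace G := ⊥
    exact continuous_snd.comp continuous_subtype_val
  continuous_tgt := by
    let : TopologicalSpace G := ⊥
    have : DiscreteTopology G := discreteTopology_bot G
    exact θ.continuous_tgt_aux
  continuous_one := by
    let : TopologicalSpace G := ⊥
    exact Continuous.subtype_mk (continuous_const.prodMk continuous_id) _
  continuous_inv := by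
    let : TopologicalSpace G := ⊥
    have : DiscreteTopology G := discreteTopology_bot G
    exact Continuous.subtype_mk ((continuous_of_discreteTopology.comp
      (continuous_fst.comp continuous_subtype_val)).prodMk θ.continuous_tgt_aux) _
  continuous_comp := by
    let : TopologicalSpace G := ⊥
    have : DiscreteTopology G := discreteTopology_bot G
    have h1 : Continuous fun p : θ.Arrow => p.1 := continuous_subtype_val
    have hf := h1.comp (continuous_fst.comp (continuous_subtype_val
      (p := fun z : θ.Arrow × θ.Arrow => z.1.1.2 = θ.toHomeo z.2.1.1 z.2.1.2)))
    have hs := h1.comp (continuous_snd.comp (continuous_subtype_val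
      (p := fun z : θ.Arrow × θ.Arrow => z.1.1.2 = θ.toHomeo z.2.1.1 z.2.1.2)))
    exact Continuous.subtype_mk (((continuous_of_discreteTopology (f := fun z : G × G =>
      z.1 * z.2)).comp ((continuous_fst.comp hf).prodMk (continuous_fst.comp hs))).prodMk
      (continuous_snd.comp hs)) _

end TopPartialAction

/-! ### Algebraic actions, constructible subgroups and the completion -/

/-- An algebraic action of a monoid `S` on an abelian group `A`, by injective endomorphisms. -/
structure AlgebraicAction (S : Type u) (A : Type v) [Monoid S] [AddCommGroup A] where
  toEnd : S →* AddMonoid.End A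
  injective : ∀ s, Function.Injective (toEnd s)

namespace AlgebraicAction

variable {S : Type u} {A : Type v} [Monoid S] [AddCommGroup A] (σ : AlgebraicAction S A)

/-- The smallest family of subgroups of `A` that contains `A` and is closed under images and
preimages along the endomorphisms `σ_s`. -/
inductive IsConstructible : AddSubgroup A → Prop
  | top : IsConstructible ⊤
  | map (s : S) {C : AddSubgroup A} : IsConstructible C → IsConstructible (C.map (σ.toEnd s))
  | comap (s : S) {C : AddSubgroup A} : IsConstructible C → IsConstructible (C.comap (σ.toEnd s))

theorem IsConstructible.inf {σ : AlgebraicAction S A} {C : AddSubgroup A} (hC : σ.IsConstructible C) :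
    ∀ {D : AddSubgroup A}, σ.IsConstructible D → σ.IsConstructible (C ⊓ D) := by
  induction hC with
  | top => intro D hD; simpa using hD
  | @map s C _ ih =>
    intro D hD
    have h : C.map (σ.toEnd s) ⊓ D = (C ⊓ D.comap (σ.toEnd s)).map (σ.toEnd s) := by
      ext a
      constructor
      · rintro ⟨⟨c, hc, rfl⟩, ha⟩
        exact ⟨c, ⟨hc, ha⟩, rfl⟩
      · rintro ⟨c, ⟨hc, ha⟩, rfl⟩
        exact ⟨⟨c, hc, rfl⟩, ha⟩
    rw [h]
    exact .map s (ih (.comap s hD))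
  | @comap s C _ ih =>
    intro D hD
    have h : C.comap (σ.toEnd s) ⊓ D = (C ⊓ D.map (σ.toEnd s)).comap (σ.toEnd s) := by
      ext a
      constructor
      · rintro ⟨hc, ha⟩
        exact ⟨hc, a, ha, rfl⟩
      · rintro ⟨hc, b, hb, hba⟩
        exact ⟨hc, σ.injective s hba ▸ hb⟩
    rw [h]
    exact .comap s (ih (.map s hD))

/-- The constructible subgroups of `A`. -/
def Constr : Type v := {C : AddSubgroup A // σ.IsConstructible C}

/-- The completion of `A`: the inverse limit of the quotients `A ⧸ C` over all constructible `C`,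
ordered by inclusion. -/
def Completion : Type v :=
  {x : (C : σ.Constr) → A ⧸ C.1 // ∀ (C D : σ.Constr) (h : C.1 ≤ D.1),
    QuotientAddGroup.map C.1 D.1 (AddMonoidHom.id A) h (x C) = x D}

/-- The inverse limit topology, each `A ⧸ C` being discrete. -/
instance : TopologicalSpace σ.Completion :=
  @instTopologicalSpaceSubtype _ _ (@Pi.topologicalSpace σ.Constr (fun C => A ⧸ C.1) fun _ => ⊥)

/-- The canonical map from `A` to its completion. -/
def toCompletion (a : A) : σ.Completion := ⟨fun _ => (a : A ⧸ _), fun _ _ _ => rfl⟩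

variable {σ}

theorem Completion.exists_rep (x : σ.Completion) (C : σ.Constr) : ∃ a : A, (a : A ⧸ C.1) = x.1 C :=
  QuotientAddGroup.mk_surjective _

theorem Completion.eq_of_le (x : σ.Completion) {C D : σ.Constr} (h : C.1 ≤ D.1) {a : A}
    (ha : (a : A ⧸ C.1) = x.1 C) : (a : A ⧸ D.1) = x.1 D := by
  rw [← x.2 C D h, ← ha]; rfl

theorem Completion.isOpen_cylinder (C : σ.Constr) (s : Set (A ⧸ C.1)) :
    IsOpen {x : σ.Completion | x.1 C ∈ s} := by
  let _ : ∀ C : σ.Constr, TopologicalSpace (A ⧸ C.1) := fun _ => ⊥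
  have h : Continuous fun x : σ.Completion => x.1 C :=
    (continuous_apply C).comp continuous_subtype_val
  have : DiscreteTopology (A ⧸ C.1) := discreteTopology_bot _
  exact (isOpen_discrete s).preimage h

theorem Completion.exists_cylinder {x : σ.Completion} {U : Set σ.Completion} (hU : U ∈ 𝓝 x) :
    ∃ C : σ.Constr, ∀ y : σ.Completion, y.1 C = x.1 C → y ∈ U := by
  let _ : ∀ C : σ.Constr, TopologicalSpace (A ⧸ C.1) := fun _ => ⊥
  have : ∀ C : σ.Constr, DiscreteTopology (A ⧸ C.1) := fun _ => discreteTopology_bot _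
  obtain ⟨V, hV, hVU⟩ := mem_nhds_induced Subtype.val x U |>.1 hU
  rw [nhds_pi, Filter.mem_pi] at hV
  obtain ⟨I, hI, t, ht, hts⟩ := hV
  have key : ∃ C : σ.Constr, ∀ D ∈ I, C.1 ≤ D.1 := by
    clear hts
    induction I, hI using Set.Finite.induction_on with
    | empty => exact ⟨⟨⊤, .top⟩, by simp⟩
    | @insert D I _ _ ih =>
      obtain ⟨C, hC⟩ := ih
      refine ⟨⟨C.1 ⊓ D.1, C.2.inf D.2⟩, ?_⟩
      rintro E (rfl | hE)
      · exact inf_le_right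
      · exact inf_le_left.trans (hC E hE)
  obtain ⟨C, hC⟩ := key
  refine ⟨C, fun y hy => hVU (hts fun D hD => ?_)⟩
  have : y.1 D = x.1 D := by rw [← y.2 C D (hC D hD), ← x.2 C D (hC D hD), hy]
  rw [this]
  exact mem_of_mem_nhds (ht D)

end AlgebraicAction

/-! ### Globalizations and the groupoid of an algebraic action -/

/-- A (minimal) globalization of an algebraic action of `S` on `A`: a group `T` generated by `S`,
and an action of `T` on an abelian group `B` that contains `A`, is generated by the translates of
`A`, and extends the action of `S` on `A`. -/
structure Globalization {S : Type u} {A : Type v} [Monoid S] [AddCommGroup A]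
    (σ : AlgebraicAction S A) (T : Type w) (B : Type x) [Group T] [AddCommGroup B] where
  act : T →* AddMonoid.End B
  ι : S →* T
  j : A →+ B
  ι_injective : Function.Injective ι
  j_injective : Function.Injective j
  act_ι : ∀ s a, act (ι s) (j a) = j (σ.toEnd s a)
  closure_ι : Subgroup.closure (Set.range ι) = ⊤
  closure_act : AddSubgroup.closure {b | ∃ t a, act t (j a) = b} = ⊤

namespace Globalization

variable {S : Type u} {A : Type v} [Monoid S] [AddCommGroup A] {σ : AlgebraicAction S A}
  {T : Type w} {B : Type x} [Group T] [AddCommGroup B] (γ : Globalization σ T B)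

theorem act_mul (s t : T) (b : B) : γ.act (s * t) b = γ.act s (γ.act t b) := by
  rw [map_mul]; rfl

theorem act_one (b : B) : γ.act 1 b = b := by
  rw [map_one]; rfl

/-- The action of `T` on `B`, as a homomorphism to the automorphisms of `B` written
multiplicatively. -/
def toMulAut : T →* MulAut (Multiplicative B) where
  toFun t :=
    { toFun := fun b => .ofAdd (γ.act t b.toAdd)
      invFun := fun b => .ofAdd (γ.act t⁻¹ b.toAdd)
      left_inv := fun b => by simp [← γ.act_mul]
      right_inv := fun b => by simp [← γ.act_mul]
      map_mul' := fun b c => by simp }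
  map_one' := by ext b; exact γ.act_one _
  map_mul' s t := by ext b; exact γ.act_mul _ _ _

/-- The semidirect product `B ⋊ T`. -/
abbrev AffineGroup : Type (max x w) := Multiplicative B ⋊[γ.toMulAut] T

/-- The affine action `(z, t).b = z + t.b` of `B ⋊ T` on `B`. -/
def affine (g : γ.AffineGroup) (b : B) : B := g.left.toAdd + γ.act g.right b

theorem affine_one (b : B) : γ.affine 1 b = b := by
  simp [affine]

theorem affine_mul (g h : γ.AffineGroup) (b : B) :
    γ.affine (g * h) b = γ.affine g (γ.affine h b) := by
  simp only [affine, SemidirectProduct.mul_left, SemidirectProduct.mul_right, γ.act_mul, map_add,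
    toAdd_mul, add_assoc]
  rfl

theorem affine_add (g : γ.AffineGroup) (b c : B) :
    γ.affine g (b + c) = γ.affine g b + γ.act g.right c := by
  simp [affine, add_assoc]

theorem affine_inv_eq {g : γ.AffineGroup} {b c : B} (h : γ.affine g b = c) :
    γ.affine g⁻¹ c = b := by
  rw [← h, ← affine_mul, inv_mul_cancel, affine_one]

/-- The partial bijection `A ∩ g⁻¹.A → g.A ∩ A`, `a ↦ g.a`, of `A` extends uniquely by continuity
to the completion of `A`; the graph of the extension is the closure of the graph of this partial
bijection. -/
def graph (g : γ.AffineGroup) : Set (σ.Completion × σ.Completion) :=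
  closure {p | ∃ a b : A, γ.affine g (γ.j a) = γ.j b ∧ p = (σ.toCompletion a, σ.toCompletion b)}

variable {γ}

theorem exists_constr (t : T) (C : σ.Constr) :
    ∃ D : σ.Constr, ∀ d ∈ D.1, ∃ c ∈ C.1, γ.act t (γ.j d) = γ.j c := by
  have ht : t ∈ Subgroup.closure (Set.range γ.ι) := by rw [γ.closure_ι]; trivial
  induction ht using Subgroup.closure_induction'' generalizing C with
  | mem _ hx =>
    obtain ⟨s, rfl⟩ := hx
    exact ⟨⟨_, .comap s C.2⟩, fun d hd => ⟨_, hd, γ.act_ι s d⟩⟩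
  | inv_mem _ hx =>
    obtain ⟨s, rfl⟩ := hx
    refine ⟨⟨_, .map s C.2⟩, ?_⟩
    rintro _ ⟨c, hc, rfl⟩
    refine ⟨c, hc, ?_⟩
    have h : γ.j (σ.toEnd s c) = γ.act (γ.ι s) (γ.j c) := (γ.act_ι s c).symm
    exact (congrArg _ h).trans (by rw [← γ.act_mul, inv_mul_cancel, γ.act_one])
  | one => exact ⟨C, fun d hd => ⟨d, hd, γ.act_one _⟩⟩
  | mul s t _ _ ihs iht =>
    obtain ⟨D, hD⟩ := ihs C
    obtain ⟨E, hE⟩ := iht D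
    refine ⟨E, fun e he => ?_⟩
    obtain ⟨d, hd, h⟩ := hE e he
    obtain ⟨c, hc, h'⟩ := hD d hd
    exact ⟨c, hc, by rw [γ.act_mul, h, h']⟩

theorem mem_graph_iff {g : γ.AffineGroup} {x y : σ.Completion} :
    (x, y) ∈ γ.graph g ↔ ∀ C : σ.Constr, ∃ a b : A, γ.affine g (γ.j a) = γ.j b ∧
      (a : A ⧸ C.1) = x.1 C ∧ (b : A ⧸ C.1) = y.1 C := by
  rw [graph, mem_closure_iff_nhds]
  constructor
  · intro h C
    obtain ⟨_, ⟨hx, hy⟩, a, b, hab, rfl⟩ := h _ (prod_mem_nhds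
      ((AlgebraicAction.Completion.isOpen_cylinder C {x.1 C}).mem_nhds rfl)
      ((AlgebraicAction.Completion.isOpen_cylinder C {y.1 C}).mem_nhds rfl))
    exact ⟨a, b, hab, hx, hy⟩
  · intro h U hU
    obtain ⟨V, hV, W, hW, hVW⟩ := mem_nhds_prod_iff.1 hU
    obtain ⟨C, hC⟩ := AlgebraicAction.Completion.exists_cylinder hV
    obtain ⟨D, hD⟩ := AlgebraicAction.Completion.exists_cylinder hW
    obtain ⟨a, b, hab, ha, hb⟩ := h ⟨C.1 ⊓ D.1, C.2.inf D.2⟩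
    exact ⟨_, hVW ⟨hC (σ.toCompletion a) (x.eq_of_le inf_le_left ha),
      hD (σ.toCompletion b) (y.eq_of_le inf_le_right hb)⟩, a, b, hab, rfl⟩

theorem graph_shift {g : γ.AffineGroup} {a b : A} (hab : γ.affine g (γ.j a) = γ.j b)
    {C D : σ.Constr} (hD : ∀ d ∈ D.1, ∃ c ∈ C.1, γ.act g.right (γ.j d) = γ.j c) {a' : A}
    (ha' : (a' : A ⧸ D.1) = a) :
    ∃ b' : A, γ.affine g (γ.j a') = γ.j b' ∧ (b' : A ⧸ C.1) = b := by
  obtain ⟨c, hc, h⟩ := hD (-a + a') (QuotientAddGroup.eq.1 ha'.symm)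
  refine ⟨b + c, ?_, ?_⟩
  · rw [map_add, ← h, ← hab, ← affine_add, ← map_add, add_neg_cancel_left]
  · exact (QuotientAddGroup.eq.2 (by simpa using hc)).symm

theorem graph_lim {g : γ.AffineGroup} {x y : σ.Completion} (h : (x, y) ∈ γ.graph g)
    (C : σ.Constr) : ∃ D : σ.Constr, ∀ a : A, (a : A ⧸ D.1) = x.1 D →
      ∃ b : A, γ.affine g (γ.j a) = γ.j b ∧ (b : A ⧸ C.1) = y.1 C := by
  obtain ⟨D, hD⟩ := exists_constr (γ := γ) g.right C
  obtain ⟨a, b, hab, ha, hb⟩ := mem_graph_iff.1 h ⟨C.1 ⊓ D.1, C.2.inf D.2⟩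
  refine ⟨D, fun a' ha' => ?_⟩
  obtain ⟨b', hab', hb'⟩ := graph_shift hab hD (a' := a')
    (ha'.trans (x.eq_of_le inf_le_right ha).symm)
  exact ⟨b', hab', hb'.trans (y.eq_of_le inf_le_left hb)⟩

theorem graph_near {g : γ.AffineGroup} {x y : σ.Completion} (h : (x, y) ∈ γ.graph g)
    (C : σ.Constr) : ∃ D : σ.Constr, ∀ x' y', (x', y') ∈ γ.graph g → x'.1 D = x.1 D →
      y'.1 C = y.1 C := by
  obtain ⟨D, hD⟩ := graph_lim h C
  refine ⟨D, fun x' y' h' hx => ?_⟩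
  obtain ⟨a, b, hab, ha, hb⟩ := mem_graph_iff.1 h' ⟨C.1 ⊓ D.1, C.2.inf D.2⟩
  obtain ⟨b', hab', hb'⟩ := hD a ((x'.eq_of_le inf_le_right ha).trans hx)
  rw [← hb', ← y'.eq_of_le inf_le_left hb, γ.j_injective (hab.symm.trans hab')]

theorem graph_unique {g : γ.AffineGroup} {x y y' : σ.Completion} (h : (x, y) ∈ γ.graph g)
    (h' : (x, y') ∈ γ.graph g) : y = y' := by
  refine Subtype.ext (funext fun C => ?_)
  obtain ⟨D, hD⟩ := graph_near h' C
  exact hD x y h rfl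

theorem graph_inv {g : γ.AffineGroup} {x y : σ.Completion} (h : (x, y) ∈ γ.graph g) :
    (y, x) ∈ γ.graph g⁻¹ := by
  refine mem_graph_iff.2 fun C => ?_
  obtain ⟨a, b, hab, ha, hb⟩ := mem_graph_iff.1 h C
  exact ⟨b, a, affine_inv_eq γ hab, hb, ha⟩

theorem graph_mul {g h : γ.AffineGroup} {x y z : σ.Completion} (hxy : (x, y) ∈ γ.graph g)
    (hyz : (y, z) ∈ γ.graph h) : (x, z) ∈ γ.graph (h * g) := by
  refine mem_graph_iff.2 fun C => ?_
  obtain ⟨D, hD⟩ := graph_lim hyz C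
  obtain ⟨a, b, hab, ha, hb⟩ := mem_graph_iff.1 hxy ⟨C.1 ⊓ D.1, C.2.inf D.2⟩
  obtain ⟨c, hbc, hc⟩ := hD b (y.eq_of_le inf_le_right hb)
  exact ⟨a, c, by rw [affine_mul, hab, hbc], x.eq_of_le inf_le_left ha, hc⟩

theorem graph_one (x : σ.Completion) : (x, x) ∈ γ.graph 1 := by
  refine mem_graph_iff.2 fun C => ?_
  obtain ⟨a, ha⟩ := x.exists_rep C
  exact ⟨a, a, affine_one γ _, ha, ha⟩

theorem exists_graph (g : γ.AffineGroup) : ∃ D : σ.Constr, ∀ (x : σ.Completion) (a b : A),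
    (a : A ⧸ D.1) = x.1 D → γ.affine g (γ.j a) = γ.j b → ∃ y, (x, y) ∈ γ.graph g := by
  choose M hM using exists_constr (γ := γ) g.right
  refine ⟨M ⟨⊤, .top⟩, fun x a b ha hab => ?_⟩
  let N (C : σ.Constr) : σ.Constr :=
    ⟨C.1 ⊓ ((M C).1 ⊓ (M ⟨⊤, .top⟩).1), C.2.inf ((M C).2.inf (M ⟨⊤, .top⟩).2)⟩
  have key (C : σ.Constr) : ∃ c d : A, γ.affine g (γ.j c) = γ.j d ∧
      (c : A ⧸ (N C).1) = x.1 (N C) := by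
    obtain ⟨c, hc⟩ := x.exists_rep (N C)
    obtain ⟨d, hcd, -⟩ := graph_shift hab (hM _) (a' := c)
      ((x.eq_of_le (inf_le_right.trans inf_le_right) hc).trans ha.symm)
    exact ⟨c, d, hcd, hc⟩
  choose c d hcd hc using key
  have shift (C : σ.Constr) (c' d' : A) (h : γ.affine g (γ.j c') = γ.j d')
      (h' : (c' : A ⧸ (N C).1) = x.1 (N C)) : (d' : A ⧸ C.1) = d C := by
    obtain ⟨e, he, he'⟩ := graph_shift (hcd C) (hM C) (a' := c')
      ((x.eq_of_le (inf_le_right.trans inf_le_left) h').trans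
        (x.eq_of_le (inf_le_right.trans inf_le_left) (hc C)).symm)
    rwa [γ.j_injective (h.symm.trans he)]
  refine ⟨⟨fun C => (d C : A ⧸ C.1), fun C D hCD => ?_⟩, mem_graph_iff.2 fun C =>
    ⟨c C, d C, hcd C, x.eq_of_le inf_le_left (hc C), rfl⟩⟩
  obtain ⟨e, he⟩ := x.exists_rep ⟨(N C).1 ⊓ (N D).1, (N C).2.inf (N D).2⟩
  obtain ⟨f, hef, -⟩ := graph_shift hab (hM _) (a' := e)
    ((x.eq_of_le (inf_le_left.trans (inf_le_right.trans inf_le_right)) he).trans ha.symm)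
  have h₁ := shift C e f hef (x.eq_of_le inf_le_left he)
  have h₂ := shift D e f hef (x.eq_of_le inf_le_right he)
  exact (congrArg (QuotientAddGroup.map C.1 D.1 (AddMonoidHom.id A) hCD) h₁.symm).trans h₂

variable (γ)

/-- The domain of `g` in the completion of `A`. -/
def domain (g : γ.AffineGroup) : Set σ.Completion := {x | ∃ y, (x, y) ∈ γ.graph g}

open Classical in
/-- The extension of the partial bijection of `A` given by `g` to the completion, on its domain
(the value outside of the domain is irrelevant). -/
noncomputable def extend (g : γ.AffineGroup) (x : σ.Completion) : σ.Completion :=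
  if h : x ∈ γ.domain g then h.choose else x

variable {γ}

theorem extend_mem_graph {g : γ.AffineGroup} {x : σ.Completion} (h : x ∈ γ.domain g) :
    (x, γ.extend g x) ∈ γ.graph g := by
  rw [extend, dif_pos h]; exact h.choose_spec

theorem extend_eq {g : γ.AffineGroup} {x y : σ.Completion} (h : (x, y) ∈ γ.graph g) :
    γ.extend g x = y :=
  graph_unique (extend_mem_graph ⟨y, h⟩) h

theorem isOpen_domain (g : γ.AffineGroup) : IsOpen (γ.domain g) := by
  rw [isOpen_iff_mem_nhds]
  rintro x ⟨y, h⟩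
  obtain ⟨D, hD⟩ := exists_graph (γ := γ) g
  obtain ⟨a, b, hab, ha, -⟩ := mem_graph_iff.1 h D
  exact Filter.mem_of_superset
    ((AlgebraicAction.Completion.isOpen_cylinder D {x.1 D}).mem_nhds rfl)
    fun x' hx' => hD x' a b (ha.trans (show x'.1 D = x.1 D from hx').symm) hab

theorem continuousOn_extend (g : γ.AffineGroup) : ContinuousOn (γ.extend g) (γ.domain g) := by
  intro x hx U hU
  obtain ⟨C, hC⟩ := AlgebraicAction.Completion.exists_cylinder hU
  obtain ⟨D, hD⟩ := graph_near (extend_mem_graph hx) C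
  refine Filter.mem_map.2 (mem_nhdsWithin_iff_exists_mem_nhds_inter.2 ⟨_,
    (AlgebraicAction.Completion.isOpen_cylinder D {x.1 D}).mem_nhds rfl, ?_⟩)
  rintro x' ⟨hx', hd⟩
  exact hC _ (hD x' _ (extend_mem_graph hd) hx')

theorem extend_mem_domain_inv {g : γ.AffineGroup} {x : σ.Completion} (h : x ∈ γ.domain g) :
    γ.extend g x ∈ γ.domain g⁻¹ :=
  ⟨x, graph_inv (extend_mem_graph h)⟩

theorem extend_inv_extend {g : γ.AffineGroup} {x : σ.Completion} (h : x ∈ γ.domain g) :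
    γ.extend g⁻¹ (γ.extend g x) = x :=
  extend_eq (graph_inv (extend_mem_graph h))

variable (γ)

/-- The partial action of `B ⋊ T` on the completion of `A` that extends the partial action of
`B ⋊ T` on `A` by affine maps. -/
noncomputable def partialAction : TopPartialAction γ.AffineGroup σ.Completion where
  toHomeo g :=
    { toFun := γ.extend g
      invFun := γ.extend g⁻¹
      source := γ.domain g
      target := γ.domain g⁻¹
      map_source' := fun _ h => extend_mem_domain_inv h
      map_target' := fun _ h => by simpa using extend_mem_domain_inv h
      left_inv' := fun _ h => extend_inv_extend h
      right_inv' := fun _ h => by simpa using extend_inv_extend h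
      open_source := isOpen_domain g
      open_target := isOpen_domain g⁻¹
      continuousOn_toFun := continuousOn_extend g
      continuousOn_invFun := continuousOn_extend g⁻¹ }
  source_one := Set.eq_univ_of_forall fun x => ⟨x, graph_one x⟩
  apply_one x := extend_eq (graph_one x)
  source_inv _ := rfl
  apply_inv_apply _ _ h := extend_inv_extend h
  mem_source_mul _ _ _ hx hy := ⟨_, graph_mul (extend_mem_graph hx) (extend_mem_graph hy)⟩
  apply_mul _ _ _ hx hy := extend_eq (graph_mul (extend_mem_graph hx) (extend_mem_graph hy))

/-- The groupoid of an algebraic action of `S` on `A`: the transformation groupoid of the partial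
action of `B ⋊ T` on the completion of `A`. -/
noncomputable def groupoid : TopGroupoid := γ.partialAction.groupoid

end Globalization

/-! ### Multiplication actions of matrix rings -/

/-- The multiplicative monoid of left regular elements of a ring, i.e. of those `a` for which
`x ↦ a * x` is injective. -/
def leftRegular (R : Type u) [Monoid R] : Submonoid R where
  carrier := {a | IsLeftRegular a}
  one_mem' := isRegular_one.left
  mul_mem' := IsLeftRegular.mul

/-- The action of the left regular elements of a ring `R` on `R` by left multiplication. -/
def leftRegularAction (R : Type u) [Ring R] : AlgebraicAction (leftRegular R) R where
  toEnd := (Module.toAddMonoidEnd R R).toMonoidHom.comp (leftRegular R).subtype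
  injective s := s.2

/-- The action of the left regular elements of a ring `R` on a left ideal of `R` by left
multiplication. -/
def leftRegularActionOnIdeal (R : Type u) [Ring R] (J : Ideal R) :
    AlgebraicAction (leftRegular R) J where
  toEnd := (Module.toAddMonoidEnd R J).toMonoidHom.comp (leftRegular R).subtype
  injective s _ _ h := Subtype.ext (s.2 (congrArg Subtype.val h))

section Matrix

open NumberField

/-- The inclusion of `M_n(R)` in `M_n(K)`, where `R` is the ring of integers of `K`. -/
noncomputable def matrixInclusion (K : Type u) [Field K] (n : ℕ) :
    Matrix (Fin n) (Fin n) (𝓞 K) →+* Matrix (Fin n) (Fin n) K :=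
  (algebraMap (𝓞 K) K).mapMatrix

theorem matrixInclusion_injective (K : Type u) [Field K] (n : ℕ) : Function.Injective (matrixInclusion K n) :=
  Matrix.map_injective (FaithfulSMul.algebraMap_injective (𝓞 K) K)

variable (K : Type u) [Field K] [NumberField K] (n : ℕ)

theorem isUnit_matrixInclusion (K : Type u) [Field K] (n : ℕ)
    (a : leftRegular (Matrix (Fin n) (Fin n) (𝓞 K))) :
    IsUnit (matrixInclusion K n a) := by
  rw [Matrix.isUnit_iff_isUnit_det, matrixInclusion, ← RingHom.map_det, isUnit_iff_ne_zero]
  intro h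
  have h0 : a.1.det = 0 := FaithfulSMul.algebraMap_injective (𝓞 K) K (h.trans (map_zero _).symm)
  obtain ⟨v, hv, hav⟩ := Matrix.exists_mulVec_eq_zero_iff.2 h0
  apply hv
  have h1 : a.1 * Matrix.of (fun i (_ : Fin n) => v i) = a.1 * 0 := by
    rw [mul_zero]
    exact Matrix.ext fun i _ => congrFun hav i
  funext i
  exact congrFun (congrFun (a.2 h1) i) i

/-- The embedding of the left regular elements of `M_n(R)` in `GL_n(K)`. -/
noncomputable def leftRegularToGL :
    leftRegular (Matrix (Fin n) (Fin n) (𝓞 K)) →* GL (Fin n) K :=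
  IsUnit.liftRight ((matrixInclusion K n).toMonoidHom.comp (Submonoid.subtype _))
    (isUnit_matrixInclusion K n)

theorem coe_leftRegularToGL (a : leftRegular (Matrix (Fin n) (Fin n) (𝓞 K))) :
    (leftRegularToGL K n a : Matrix (Fin n) (Fin n) K) = matrixInclusion K n a :=
  IsUnit.coe_liftRight _ _ _

theorem leftRegularToGL_injective : Function.Injective (leftRegularToGL K n) := fun a b h =>
  Subtype.ext (matrixInclusion_injective K n (by
    rw [← coe_leftRegularToGL, ← coe_leftRegularToGL, h]))

/-- The action of `GL_n(K)` on `M_n(K)` by left multiplication. -/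
def actGL : GL (Fin n) K →* AddMonoid.End (Matrix (Fin n) (Fin n) K) :=
  (Module.toAddMonoidEnd (Matrix (Fin n) (Fin n) K) (Matrix (Fin n) (Fin n) K)).toMonoidHom.comp
    (Units.coeHom _)

variable {K n}

theorem exists_denominator (X : Matrix (Fin n) (Fin n) K) {I : Ideal (𝓞 K)} (hI : I ≠ ⊥) :
    ∃ d : leftRegular (Matrix (Fin n) (Fin n) (𝓞 K)), ∃ Y ∈ I.matrix (Fin n),
      matrixInclusion K n d * X = matrixInclusion K n Y := by
  obtain ⟨c, hc, hc0⟩ := Submodule.exists_mem_ne_zero_of_ne_bot hI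
  obtain ⟨b, hb⟩ := IsLocalization.exist_integer_multiples_of_finite (nonZeroDivisors (𝓞 K))
    (fun p : Fin n × Fin n => X p.1 p.2)
  choose y hy using hb
  have hcb : c * b ≠ 0 := mul_ne_zero hc0 (nonZeroDivisors.coe_ne_zero b)
  refine ⟨⟨Matrix.scalar (Fin n) (c * b), fun Y Z h => ?_⟩, Matrix.of fun i j => c * y (i, j),
    fun i j => I.mul_mem_right _ hc, ?_⟩
  · refine Matrix.ext fun i j => ?_
    have := congrFun (congrFun h i) j
    simp only [Matrix.scalar_apply, Matrix.diagonal_mul] at this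
    exact mul_left_cancel₀ hcb this
  · ext i j
    have := hy (i, j)
    simp only [Algebra.smul_def] at this
    simp [matrixInclusion, Matrix.scalar_apply, Matrix.diagonal_map, Matrix.diagonal_mul, this,
      mul_assoc]

theorem closure_leftRegularToGL :
    Subgroup.closure (Set.range (leftRegularToGL K n)) = ⊤ := by
  rw [eq_top_iff]
  intro g _
  obtain ⟨d, Y, -, h⟩ := exists_denominator (g : Matrix (Fin n) (Fin n) K)
    (I := (⊤ : Ideal (𝓞 K))) top_ne_bot
  have hY : Y ∈ leftRegular (Matrix (Fin n) (Fin n) (𝓞 K)) := by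
    intro Z W hZW
    have hu : IsUnit (matrixInclusion K n Y) := by
      rw [← h]
      exact (isUnit_matrixInclusion K n d).mul g.isUnit
    have h2 := congrArg (matrixInclusion K n) hZW
    simp only [map_mul] at h2
    exact matrixInclusion_injective K n (hu.mul_left_cancel h2)
  have hg : g = (leftRegularToGL K n d)⁻¹ * leftRegularToGL K n ⟨Y, hY⟩ := by
    rw [eq_inv_mul_iff_mul_eq]
    ext1
    rw [Units.val_mul, coe_leftRegularToGL, coe_leftRegularToGL, h]
  rw [hg]
  exact mul_mem (inv_mem (Subgroup.subset_closure ⟨d, rfl⟩)) (Subgroup.subset_closure ⟨_, rfl⟩)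

theorem exists_actGL_eq (X : Matrix (Fin n) (Fin n) K) {I : Ideal (𝓞 K)} (hI : I ≠ ⊥) :
    ∃ g : GL (Fin n) K, ∃ Y ∈ I.matrix (Fin n), actGL K n g (matrixInclusion K n Y) = X := by
  obtain ⟨d, Y, hY, h⟩ := exists_denominator X hI
  refine ⟨(leftRegularToGL K n d)⁻¹, Y, hY, ?_⟩
  change ((leftRegularToGL K n d)⁻¹ : GL (Fin n) K).1 * matrixInclusion K n Y = X
  rw [← h, ← coe_leftRegularToGL, ← mul_assoc, ← Units.val_mul, inv_mul_cancel, Units.val_one,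
    one_mul]

variable (K n)

/-- The globalization `GL_n(K) ↷ M_n(K)` of the multiplication action of the left regular elements
of `M_n(R)` on `M_n(R)`, where `R` is the ring of integers of `K`. -/
noncomputable def matrixGlobalization :
    Globalization (leftRegularAction (Matrix (Fin n) (Fin n) (𝓞 K))) (GL (Fin n) K)
      (Matrix (Fin n) (Fin n) K) where
  act := actGL K n
  ι := leftRegularToGL K n
  j := (matrixInclusion K n).toAddMonoidHom
  ι_injective := leftRegularToGL_injective K n
  j_injective := matrixInclusion_injective K n
  act_ι s a := by
    change (leftRegularToGL K n s).1 * matrixInclusion K n a = matrixInclusion K n (s.1 * a)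
    rw [coe_leftRegularToGL, map_mul]
  closure_ι := closure_leftRegularToGL
  closure_act := by
    rw [eq_top_iff]
    intro X _
    obtain ⟨g, Y, -, h⟩ := exists_actGL_eq X (I := (⊤ : Ideal (𝓞 K))) top_ne_bot
    exact AddSubgroup.subset_closure ⟨g, Y, h⟩

/-- The groupoid `(M_n(K) ⋊ GL_n(K)) ⋉ M_n(R)^` of the multiplication action of the left regular
elements of `M_n(R)` on `M_n(R)`, where `R` is the ring of integers of `K` and `M_n(R)^` is the
completion of `M_n(R)`. -/
noncomputable def matrixGroupoid : TopGroupoid := (matrixGlobalization K n).groupoid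

/-- The globalization `GL_n(K) ↷ M_n(K)` of the multiplication action of the left regular elements
of `M_n(R)` on `M_n(I)`, where `I` is a nonzero ideal of the ring of integers `R` of `K`. -/
noncomputable def matrixIdealGlobalization (I : Ideal (𝓞 K)) (hI : I ≠ ⊥) :
    Globalization (leftRegularActionOnIdeal (Matrix (Fin n) (Fin n) (𝓞 K)) (I.matrix (Fin n)))
      (GL (Fin n) K) (Matrix (Fin n) (Fin n) K) where
  act := actGL K n
  ι := leftRegularToGL K n
  j := (matrixInclusion K n).toAddMonoidHom.comp (I.matrix (Fin n)).toAddSubgroup.subtype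
  ι_injective := leftRegularToGL_injective K n
  j_injective := (matrixInclusion_injective K n).comp Subtype.val_injective
  act_ι s a := by
    change (leftRegularToGL K n s).1 * matrixInclusion K n a = matrixInclusion K n (s.1 * a.1)
    rw [coe_leftRegularToGL, map_mul]
  closure_ι := closure_leftRegularToGL
  closure_act := by
    rw [eq_top_iff]
    intro X _
    obtain ⟨g, Y, hY, h⟩ := exists_actGL_eq X hI
    exact AddSubgroup.subset_closure ⟨g, ⟨Y, hY⟩, h⟩

/-- The groupoid `(M_n(K) ⋊ GL_n(K)) ⋉ M_n(I)^` of the multiplication action of the left regular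
elements of `M_n(R)` on `M_n(I)`, where `I` is a nonzero ideal of the ring of integers `R` of `K`
and `M_n(I)^` is the completion of `M_n(I)`. -/
noncomputable def matrixIdealGroupoid (I : Ideal (𝓞 K)) (hI : I ≠ ⊥) : TopGroupoid :=
  (matrixIdealGlobalization K n I hI).groupoid

end Matrix

-- An isomorphism of the groupoids is turned into a homeomorphism of the completions together with a
-- locally constant cocycle `val`, with values in the second affine group (`OrbitCocycle`). The aim
-- is to recover the matrix algebra from this cocycle near the origin. Both parts of the theorem are
-- treated together by allowing any nonzero ideal (`IsMatrixLattice`); the first part is the case of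
-- the unit ideal.
--
-- The lattice is finitely generated and the completion is compact, so on all translations by the
-- lattice the cocycle depends only on the class of the point modulo one constructible subgroup `C`
-- (`exists_uniform`). Hence its value at the origin is a homomorphism from `C` to the affine group.
-- The crucial fact is that its values are translations (`IsUniform.right_atZero`). Commuting affine
-- maps satisfy a symmetric relation between linear parts and displacements, and the displacements
-- are dense enough to hit every matrix modulo almost every maximal ideal. Over the residue fields
-- this forces the linear parts to be trivial.
--
-- The translation parts therefore give an injective additive map on `C`, and after clearing
-- denominators an injective `ℚ`-linear map `f` of matrix algebras. Linear maps `s` fix the origin,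
-- so the cocycle identity for `s` and a translation yields `f (s * X) = τ * f X`
-- (`exists_transfer_act`, `exists_linearMap`). The inverse isomorphism gives the opposite
-- inequality of dimensions, so `f` is bijective. If `f e = 1`, then `M ↦ f (M * e)` is an
-- isomorphism of algebras (`Matrix.nonempty_algEquiv_of_linearMap`). The center recovers the field,
-- and the dimension recovers the size. Conversely, a field isomorphism carries all data of the
-- construction along.

universe u' v' w' x'

/-! ### Translations and compactness of the completion -/

namespace AlgebraicAction

variable {S : Type u} {A : Type v} [Monoid S] [AddCommGroup A] {σ : AlgebraicAction S A}

/-- Translation by an element of `A` on the completion of `A`. -/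
def Completion.translate (x : σ.Completion) (a : A) : σ.Completion :=
  ⟨fun C => x.1 C + (a : A ⧸ C.1), fun C D h => by rw [map_add, x.2 C D h]; rfl⟩

theorem Completion.translate_toCompletion (a b : A) :
    (σ.toCompletion a).translate b = σ.toCompletion (a + b) := rfl

theorem Constr.exists_le (I : Set σ.Constr) (hI : I.Finite) :
    ∃ C : σ.Constr, ∀ D ∈ I, C.1 ≤ D.1 := by
  induction I, hI using Set.Finite.induction_on with
  | empty => exact ⟨⟨⊤, .top⟩, by simp⟩
  | @insert D I _ _ ih =>
    obtain ⟨C, hC⟩ := ih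
    refine ⟨⟨C.1 ⊓ D.1, C.2.inf D.2⟩, ?_⟩
    rintro E (rfl | hE)
    · exact inf_le_right
    · exact inf_le_left.trans (hC E hE)

theorem Completion.apply_eq_of_le {x y : σ.Completion} {C D : σ.Constr} (h : C.1 ≤ D.1)
    (hxy : x.1 C = y.1 C) : x.1 D = y.1 D := by
  rw [← x.2 C D h, ← y.2 C D h, hxy]

/-- The compatibility conditions are closed in a product of finite discrete spaces, which is compact
by Tychonoff. -/
theorem Completion.compactSpace (h : ∀ C : σ.Constr, Finite (A ⧸ C.1)) :
    CompactSpace σ.Completion := by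
  let _ : ∀ C : σ.Constr, TopologicalSpace (A ⧸ C.1) := fun _ => ⊥
  have : ∀ C : σ.Constr, DiscreteTopology (A ⧸ C.1) := fun _ => discreteTopology_bot _
  have hc : IsClosed {x : (C : σ.Constr) → A ⧸ C.1 | ∀ (C D : σ.Constr) (h : C.1 ≤ D.1),
      QuotientAddGroup.map C.1 D.1 (AddMonoidHom.id A) h (x C) = x D} := by
    simp only [Set.ofPred_forall]
    refine isClosed_iInter fun C => isClosed_iInter fun D => isClosed_iInter fun h => ?_
    exact isClosed_eq (continuous_of_discreteTopology.comp (continuous_apply C))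
      (continuous_apply D)
  exact isCompact_iff_compactSpace.1 hc.isCompact

/-- Finitely many cylinders on which `f` is constant cover the space, and the constructible
subgroups are directed downwards, so one level refines all of these cylinders. -/
theorem Completion.exists_factor [CompactSpace σ.Completion] {β : Type*} (f : σ.Completion → β)
    (hf : ∀ x, ∀ᶠ x' in 𝓝 x, f x' = f x) :
    ∃ C : σ.Constr, ∀ x x' : σ.Completion, x.1 C = x'.1 C → f x = f x' := by
  choose D hD using fun x => exists_cylinder (hf x)
  obtain ⟨t, ht⟩ := isCompact_univ.elim_finite_subcover
    (fun x : σ.Completion => {y : σ.Completion | y.1 (D x) ∈ ({x.1 (D x)} : Set _)})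
    (fun x => isOpen_cylinder (D x) _) (fun x _ => Set.mem_iUnion.2 ⟨x, rfl⟩)
  obtain ⟨C, hC⟩ := Constr.exists_le (D '' t) (t.finite_toSet.image D)
  refine ⟨C, fun x x' hx => ?_⟩
  obtain ⟨y, hy, hxy⟩ := Set.mem_iUnion₂.1 (ht (Set.mem_univ x))
  have hxy : x.1 (D y) = y.1 (D y) := hxy
  have h := apply_eq_of_le (hC _ ⟨y, hy, rfl⟩) hx
  exact (hD y x hxy).trans (hD y x' (h.symm.trans hxy)).symm

end AlgebraicAction

namespace Globalization

open AlgebraicAction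

variable {S : Type u} {A : Type v} [Monoid S] [AddCommGroup A] {σ : AlgebraicAction S A}
  {T : Type w} {B : Type x} [Group T] [AddCommGroup B] {γ : Globalization σ T B}

variable (γ) in
/-- The translation by `b`, as an element of `B ⋊ T`. -/
def translation (b : B) : γ.AffineGroup := SemidirectProduct.inl (.ofAdd b)

theorem translation_add (b c : B) :
    γ.translation (b + c) = γ.translation b * γ.translation c := by
  simp [translation]

theorem translation_zero : γ.translation 0 = 1 := by
  simp [translation]

theorem translation_injective : Function.Injective γ.translation := fun _ _ h =>
  Multiplicative.ofAdd.injective (SemidirectProduct.inl_injective h)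

theorem affine_translation (b c : B) : γ.affine (γ.translation b) c = b + c := by
  simp [translation, affine]

theorem eq_translation {g : γ.AffineGroup} (h : g.right = 1) :
    g = γ.translation g.left.toAdd :=
  SemidirectProduct.ext rfl h

theorem mul_translation (g : γ.AffineGroup) (b : B) :
    g * γ.translation b = γ.translation (γ.act g.right b) * g := by
  refine SemidirectProduct.ext ?_ (by simp [translation])
  simp only [translation, SemidirectProduct.mul_left, SemidirectProduct.left_inl,
    SemidirectProduct.right_inl, map_one, MulAut.one_apply]
  exact mul_comm _ _

theorem graph_translation (x : σ.Completion) (a : A) :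
    (x, x.translate a) ∈ γ.graph (γ.translation (γ.j a)) := by
  refine mem_graph_iff.2 fun C => ?_
  obtain ⟨b, hb⟩ := x.exists_rep C
  refine ⟨b, b + a, by rw [affine_translation, map_add, add_comm], hb, ?_⟩
  exact congrArg (· + (a : A ⧸ C.1)) hb

theorem graph_toCompletion {g : γ.AffineGroup} {a b : A} (h : γ.affine g (γ.j a) = γ.j b) :
    (σ.toCompletion a, σ.toCompletion b) ∈ γ.graph g :=
  subset_closure ⟨a, b, h, rfl⟩

/-- Taking closures adds nothing over points of `A`: membership in the domain is decided on a whole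
cylinder, and `a` lies in its own cylinder. -/
theorem exists_of_graph_toCompletion {g : γ.AffineGroup} {a : A} {y : σ.Completion}
    (h : (σ.toCompletion a, y) ∈ γ.graph g) :
    ∃ b, γ.affine g (γ.j a) = γ.j b ∧ y = σ.toCompletion b := by
  obtain ⟨D, hD⟩ := graph_lim h ⟨⊤, .top⟩
  obtain ⟨b, hb, -⟩ := hD a rfl
  exact ⟨b, hb, graph_unique h (graph_toCompletion hb)⟩

/-- If the affine maps `g` and `h` commute, then the displacements `u` and `u'` of a point by `g`
and `h` satisfy `(g₀ - 1) u' = (h₀ - 1) u` for the linear parts `g₀` and `h₀`. -/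
theorem act_displacement {g h : γ.AffineGroup} (hgh : g * h = h * g) (b : B) :
    γ.act g.right (γ.affine h b - b) - (γ.affine h b - b) =
      γ.act h.right (γ.affine g b - b) - (γ.affine g b - b) := by
  have key (g : γ.AffineGroup) (c : B) : γ.act g.right (c - b) = γ.affine g c - γ.affine g b := by
    simp [affine]
  rw [key, key, ← affine_mul, ← affine_mul, hgh]
  abel

end Globalization

/-! ### The cocycle of an isomorphism of transformation groupoids -/

section Cocycle

variable {S₁ : Type u} {A₁ : Type v} [Monoid S₁] [AddCommGroup A₁] {σ₁ : AlgebraicAction S₁ A₁}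
  {T₁ : Type w} {B₁ : Type x} [Group T₁] [AddCommGroup B₁]
  {S₂ : Type u'} {A₂ : Type v'} [Monoid S₂] [AddCommGroup A₂] {σ₂ : AlgebraicAction S₂ A₂}
  {T₂ : Type w'} {B₂ : Type x'} [Group T₂] [AddCommGroup B₂]

/-- A homeomorphism of the completions together with a locally constant cocycle that expresses the
images of the orbits of the first partial action in terms of the second one. -/
structure OrbitCocycle (γ₁ : Globalization σ₁ T₁ B₁) (γ₂ : Globalization σ₂ T₂ B₂) where
  obj : σ₁.Completion ≃ₜ σ₂.Completion
  val : γ₁.AffineGroup → σ₁.Completion → γ₂.AffineGroup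
  graph : ∀ {g x y}, (x, y) ∈ γ₁.graph g → (obj x, obj y) ∈ γ₂.graph (val g x)
  mul : ∀ {g h x y}, (x, y) ∈ γ₁.graph g → y ∈ γ₁.domain h →
    val (h * g) x = val h y * val g x
  eventually_eq : ∀ {g x}, x ∈ γ₁.domain g → ∀ᶠ x' in 𝓝 x, val g x' = val g x

variable {γ₁ : Globalization σ₁ T₁ B₁} {γ₂ : Globalization σ₂ T₂ B₂}

theorem Globalization.eventually_fst_eq (p : γ₁.groupoid.Arr) :
    ∀ᶠ q : γ₁.groupoid.Arr in 𝓝 p, q.1.1 = p.1.1 := by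
  let : TopologicalSpace γ₁.AffineGroup := ⊥
  have : DiscreteTopology γ₁.AffineGroup := discreteTopology_bot _
  have h1 : Continuous fun p : γ₁.partialAction.Arrow => p.1 := continuous_subtype_val
  exact (continuous_fst.comp h1).continuousAt.preimage_mem_nhds
    ((isOpen_discrete {p.1.1}).mem_nhds rfl)

theorem Globalization.continuous_arrow (g : γ₁.AffineGroup) :
    Continuous fun x : γ₁.domain g => show γ₁.groupoid.Arr from ⟨(g, x.1), x.2⟩ := by
  let : TopologicalSpace γ₁.AffineGroup := ⊥
  have h : Continuous fun x : γ₁.domain g => (g, x.1) :=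
    continuous_const.prodMk continuous_subtype_val
  exact continuous_induced_rng.2 h

open Classical in
/-- The cocycle of an isomorphism of groupoids. -/
noncomputable def OrbitCocycle.ofIso (Φ : TopGroupoid.Iso γ₁.groupoid γ₂.groupoid) :
    OrbitCocycle γ₁ γ₂ where
  obj := Φ.obj
  -- The default value 1 plays no role: the conditions below concern only points of the domain,
  -- which is open.
  val g x := if h : x ∈ γ₁.domain g then (Φ.arr ⟨(g, x), h⟩).1.1 else 1
  graph {g x y} h := by
    have hx : x ∈ γ₁.domain g := ⟨y, h⟩
    rw [dif_pos hx]
    have hs : (Φ.arr ⟨(g, x), hx⟩).1.2 = Φ.obj x := Φ.map_src ⟨(g, x), hx⟩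
    have ht : γ₂.extend (Φ.arr ⟨(g, x), hx⟩).1.1 (Φ.arr ⟨(g, x), hx⟩).1.2 =
        Φ.obj (γ₁.extend g x) := Φ.map_tgt ⟨(g, x), hx⟩
    rw [Globalization.extend_eq h] at ht
    have := Globalization.extend_mem_graph (Φ.arr ⟨(g, x), hx⟩).2
    rwa [ht, hs] at this
  mul {g h x y} hxy hy := by
    have hx : x ∈ γ₁.domain g := ⟨y, hxy⟩
    obtain ⟨z, hz⟩ := hy
    have hx' : x ∈ γ₁.domain (h * g) := ⟨z, Globalization.graph_mul hxy hz⟩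
    rw [dif_pos hx', dif_pos ⟨z, hz⟩, dif_pos hx]
    have := Φ.map_comp ⟨(h, y), z, hz⟩ ⟨(g, x), hx⟩ (Globalization.extend_eq hxy).symm
    exact congrArg (fun p : γ₂.groupoid.Arr => p.1.1) this
  eventually_eq {g x} hx := by
    let F (x' : γ₁.domain g) : γ₂.groupoid.Arr := Φ.arr ⟨(g, x'.1), x'.2⟩
    have hF : Continuous F := Φ.arr.continuous.comp (Globalization.continuous_arrow g)
    have h1 := (hF.tendsto ⟨x, hx⟩).eventually (Globalization.eventually_fst_eq _)
    have h2 := (eventually_nhds_subtype_iff (γ₁.domain g) ⟨x, hx⟩ (fun x' =>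
      (if h : x' ∈ γ₁.domain g then (Φ.arr ⟨(g, x'), h⟩).1.1 else 1) =
        (if h : x ∈ γ₁.domain g then (Φ.arr ⟨(g, x), h⟩).1.1 else 1))).1 (by
      filter_upwards [h1] with x' hx'
      rw [dif_pos x'.2, dif_pos hx]
      exact hx')
    rwa [(Globalization.isOpen_domain g).nhdsWithin_eq hx] at h2

/-- The inverse of an isomorphism of topological groupoids. -/
def TopGroupoid.Iso.symm {G : TopGroupoid.{u, v}} {H : TopGroupoid.{w, x}} (Φ : G.Iso H) :
    H.Iso G where
  obj := Φ.obj.symm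
  arr := Φ.arr.symm
  map_src p := by
    rw [← Φ.obj.symm_apply_apply (G.src _), ← Φ.map_src, Φ.arr.apply_symm_apply]
  map_tgt p := by
    rw [← Φ.obj.symm_apply_apply (G.tgt _), ← Φ.map_tgt, Φ.arr.apply_symm_apply]
  map_comp p q h := by
    apply Φ.arr.injective
    rw [Φ.arr.apply_symm_apply, Φ.map_comp]
    simp only [Φ.arr.apply_symm_apply]

namespace OrbitCocycle

variable (Θ : OrbitCocycle γ₁ γ₂)

theorem val_one (x : σ₁.Completion) : Θ.val 1 x = 1 := by
  have := Θ.mul (Globalization.graph_one (γ := γ₁) x) ⟨x, Globalization.graph_one x⟩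
  rwa [mul_one, left_eq_mul] at this

theorem val_translation_add (a b : A₁) (x : σ₁.Completion) :
    Θ.val (γ₁.translation (γ₁.j (a + b))) x =
      Θ.val (γ₁.translation (γ₁.j a)) (x.translate b) * Θ.val (γ₁.translation (γ₁.j b)) x := by
  rw [map_add, Globalization.translation_add]
  exact Θ.mul (Globalization.graph_translation x b) ⟨_, Globalization.graph_translation _ a⟩

/-- On a finitely generated group of translations, the cocycle depends only on the class of the
point modulo some constructible subgroup. -/
theorem exists_uniform [CompactSpace σ₁.Completion] [AddGroup.FG A₁] :
    ∃ C : σ₁.Constr, ∀ (a : A₁) (x x' : σ₁.Completion), x.1 C = x'.1 C →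
      Θ.val (γ₁.translation (γ₁.j a)) x = Θ.val (γ₁.translation (γ₁.j a)) x' := by
  obtain ⟨s, hs⟩ := AddGroup.fg_def.1 (inferInstance : AddGroup.FG A₁)
  choose D hD using fun a : A₁ => AlgebraicAction.Completion.exists_factor
    (fun x => Θ.val (γ₁.translation (γ₁.j a)) x)
    fun x => Θ.eventually_eq ⟨_, Globalization.graph_translation x a⟩
  obtain ⟨C, hC⟩ := AlgebraicAction.Constr.exists_le (D '' s) (s.finite_toSet.image D)
  refine ⟨C, fun a => ?_⟩
  have ha : a ∈ AddSubgroup.closure (s : Set A₁) := by rw [hs]; trivial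
  -- Translations preserve congruence modulo `C`. This lets uniformity pass from the generators to
  -- sums and negatives without shrinking `C`.
  have htr {x x' : σ₁.Completion} (a : A₁) (h : x.1 C = x'.1 C) :
      (x.translate a).1 C = (x'.translate a).1 C := congrArg (· + (a : A₁ ⧸ C.1)) h
  induction ha using AddSubgroup.closure_induction with
  | mem a ha =>
    exact fun x x' h => hD a x x'
      (AlgebraicAction.Completion.apply_eq_of_le (hC _ ⟨a, ha, rfl⟩) h)
  | zero => intro x x' _; rw [map_zero, Globalization.translation_zero, val_one, val_one]
  | add a b _ _ iha ihb =>
    intro x x' h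
    rw [val_translation_add, val_translation_add, ihb x x' h, iha _ _ (htr b h)]
  | neg a _ iha =>
    intro x x' h
    have key (x : σ₁.Completion) : Θ.val (γ₁.translation (γ₁.j (-a))) x =
        (Θ.val (γ₁.translation (γ₁.j a)) (x.translate (-a)))⁻¹ := by
      rw [eq_inv_iff_mul_eq_one, ← mul_eq_one_comm, ← val_translation_add, add_neg_cancel,
        map_zero, Globalization.translation_zero, val_one]
    rw [key, key, iha _ _ (htr _ h)]

end OrbitCocycle

end Cocycle

/-! ### Matrices over fields and rings of integers -/

section MatrixLemmas

open Matrix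

variable {F : Type*} [Field F] {n : Type*} [Fintype n] [DecidableEq n]

/-- A nonzero entry of `Q` allows a rank one `m` for which `k + Q * m` kills a nonzero matrix. -/
theorem Matrix.eq_zero_of_forall_isUnit_add_mul {k : ℕ} {Q : Matrix n n F}
    (h : ∀ m : Matrix n n F, IsUnit ((k : Matrix n n F) + Q * m)) : Q = 0 := by
  refine Matrix.ext fun i j => ?_
  by_contra h0
  rw [Matrix.zero_apply] at h0
  -- The scalar is chosen so that `m * Q * single j i 1 = -k * single j i 1`; the `(i, i)` entry of
  -- `Q * single j i 1` is `Q i j`.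
  have h1 : ((k : Matrix n n F) + Q * single j i (-k / Q i j)) * (Q * single j i 1) = 0 := by
    have h2 : single j i (-k / Q i j) * Q * single j i 1 = -((k : Matrix n n F) * single j i 1) := by
      rw [single_mul_mul_single, mul_one, div_mul_cancel₀ _ h0, ← nsmul_eq_mul, smul_single,
        nsmul_eq_mul, mul_one, ← single_neg]
    calc _ = (k : Matrix n n F) * Q * single j i 1 +
          Q * (single j i (-k / Q i j) * Q * single j i 1) := by noncomm_ring
      _ = 0 := by rw [h2, (Nat.cast_commute k Q).eq]; noncomm_ring
  have h2 := (h _).mul_right_eq_zero.1 h1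
  have h3 := congrFun (congrFun h2 i) i
  rw [mul_single_apply_same, mul_one] at h3
  exact h0 h3

/-- An index `e` with `u e = 1` turns the symmetric relation into `Q a = Q e * u a`. As `u a` runs
over all matrices, the previous lemma gives `Q e = 0`. -/
theorem Matrix.eq_zero_of_commuting_displacements {ι : Type*} {k : ℕ}
    {Q u : ι → Matrix n n F} (hu : Function.Surjective u) (hc : ∀ a b, Q a * u b = Q b * u a)
    (h : ∀ a, IsUnit ((k : Matrix n n F) + Q a)) (a : ι) : Q a = 0 := by
  obtain ⟨e, he⟩ := hu 1
  have key (a : ι) : Q a = Q e * u a := by rw [← hc, he, mul_one]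
  rw [key, Matrix.eq_zero_of_forall_isUnit_add_mul (Q := Q e), zero_mul]
  intro m
  obtain ⟨b, rfl⟩ := hu m
  rw [← key]
  exact h b

end MatrixLemmas

section RingOfIntegers

open NumberField

variable {K : Type u} [Field K] [NumberField K]

theorem NumberField.RingOfIntegers.exists_dvd_natCast {r : 𝓞 K} (hr : r ≠ 0) :
    ∃ m : ℕ, m ≠ 0 ∧ r ∣ m :=
  ⟨Ideal.absNorm (Ideal.span {r}), by simpa [Ideal.absNorm_eq_zero_iff] using hr,
    Ideal.mem_span_singleton.1 (Ideal.absNorm_mem _)⟩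

theorem NumberField.RingOfIntegers.eq_one_of_isUnit_natCast {m : ℕ} (h : IsUnit (m : 𝓞 K)) :
    m = 1 := by
  have h1 := NumberField.isUnit_iff_norm.1 h
  have h2 : ((m : 𝓞 K) : K) = algebraMap ℚ K m := by simp
  rw [RingOfIntegers.coe_norm, h2, Algebra.norm_algebraMap, abs_pow, Nat.abs_cast] at h1
  exact (Nat.pow_eq_one.1 (by exact_mod_cast h1)).resolve_right
    (Module.finrank_pos (R := ℚ) (M := K)).ne'

/-- A nonzero `r` divides some natural number `m ≠ 0`. Since `m + 1` is not a unit, it lies in a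
maximal ideal, which cannot also contain `m`. -/
theorem NumberField.RingOfIntegers.eq_zero_of_forall_mem_isMaximal {r : 𝓞 K}
    (h : ∀ p : Ideal (𝓞 K), p.IsMaximal → r ∈ p) : r = 0 := by
  by_contra hr
  obtain ⟨m, hm, hrm⟩ := exists_dvd_natCast hr
  obtain ⟨p, hp, hmp⟩ := exists_max_ideal_of_mem_nonunits (a := ((m + 1 : ℕ) : 𝓞 K))
    fun hu => hm (by simpa using eq_one_of_isUnit_natCast hu)
  refine hp.ne_top ((Ideal.eq_top_iff_one p).2 ?_)
  have h1 := p.sub_mem hmp (Ideal.mem_of_dvd p hrm (h p hp))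
  simpa using h1

/-- If `r` divides `m ≠ 0` and `2 * m` divides `r`, then 2 is a unit. -/
theorem NumberField.RingOfIntegers.eq_zero_of_forall_natCast_dvd {r : 𝓞 K}
    (h : ∀ m : ℕ, m ≠ 0 → (m : 𝓞 K) ∣ r) : r = 0 := by
  by_contra hr
  obtain ⟨m, hm, hrm⟩ := exists_dvd_natCast hr
  obtain ⟨t, ht⟩ := (h (2 * m) (by omega)).trans hrm
  have h2 : ((2 : ℕ) : 𝓞 K) * t = 1 := by
    have hm' : (m : 𝓞 K) ≠ 0 := Nat.cast_ne_zero.2 hm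
    apply mul_left_cancel₀ hm'
    push_cast at ht ⊢
    linear_combination -ht
  exact absurd (eq_one_of_isUnit_natCast (.of_mul_eq_one t h2)) (by norm_num)

end RingOfIntegers

/-! ### Globalizations on lattices of matrices -/

namespace Globalization

open NumberField AlgebraicAction

variable {K : Type u} [Field K] [NumberField K] {n : ℕ} {A : Type v} [AddCommGroup A]
  {σ : AlgebraicAction (leftRegular (Matrix (Fin n) (Fin n) (𝓞 K))) A}

/-- The globalization is the action of `GL_n(K)` on `M_n(K)` by left multiplication, and `A` is the
group of matrices with entries in the nonzero ideal `I`. -/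
structure IsMatrixLattice (γ : Globalization σ (GL (Fin n) K) (Matrix (Fin n) (Fin n) K))
    (I : Ideal (𝓞 K)) : Prop where
  act_eq : γ.act = actGL K n
  ι_eq : γ.ι = leftRegularToGL K n
  mem_range : ∀ X, X ∈ Set.range γ.j ↔ ∃ Y ∈ I.matrix (Fin n), matrixInclusion K n Y = X
  ne_bot : I ≠ ⊥

theorem isMatrixLattice_matrixGlobalization (K : Type u) [Field K] [NumberField K] (n : ℕ) :
    (matrixGlobalization K n).IsMatrixLattice ⊤ where
  act_eq := rfl
  ι_eq := rfl
  mem_range X := by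
    constructor
    · rintro ⟨Y, rfl⟩
      exact ⟨Y, fun _ _ => trivial, rfl⟩
    · rintro ⟨Y, -, rfl⟩
      exact ⟨Y, rfl⟩
  ne_bot := top_ne_bot

theorem isMatrixLattice_matrixIdealGlobalization (K : Type u) [Field K] [NumberField K] (n : ℕ)
    (I : Ideal (𝓞 K)) (hI : I ≠ ⊥) :
    (matrixIdealGlobalization K n I hI).IsMatrixLattice I where
  act_eq := rfl
  ι_eq := rfl
  mem_range X := by
    constructor
    · rintro ⟨Y, rfl⟩
      exact ⟨Y.1, Y.2, rfl⟩
    · rintro ⟨Y, hY, rfl⟩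
      exact ⟨⟨Y, hY⟩, rfl⟩
  ne_bot := hI

namespace IsMatrixLattice

variable {γ : Globalization σ (GL (Fin n) K) (Matrix (Fin n) (Fin n) K)} {I : Ideal (𝓞 K)}
  (hγ : γ.IsMatrixLattice I)

include hγ

theorem act_apply (g : GL (Fin n) K) (X : Matrix (Fin n) (Fin n) K) :
    γ.act g X = (g : Matrix (Fin n) (Fin n) K) * X := by
  rw [hγ.act_eq]; rfl

theorem exists_eq (a : A) : ∃ Y ∈ I.matrix (Fin n), matrixInclusion K n Y = γ.j a :=
  (hγ.mem_range _).1 ⟨a, rfl⟩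

theorem exists_j_eq_mul (Y : Matrix (Fin n) (Fin n) (𝓞 K)) (a : A) :
    ∃ b, γ.j b = matrixInclusion K n Y * γ.j a := by
  obtain ⟨Z, hZ, h⟩ := hγ.exists_eq a
  rw [← h, ← map_mul]
  exact (hγ.mem_range _).2 ⟨Y * Z, (I.matrix (Fin n)).mul_mem_left Y hZ, rfl⟩

theorem exists_nsmul_eq (X : Matrix (Fin n) (Fin n) K) :
    ∃ m : ℕ, m ≠ 0 ∧ ∃ a, m • X = γ.j a := by
  -- `b` clears the denominators, `c` moves the result into `I`, and a natural multiple of `c * b`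
  -- replaces this factor by an integer.
  obtain ⟨c, hc, hc0⟩ := Submodule.exists_mem_ne_zero_of_ne_bot hγ.ne_bot
  obtain ⟨b, hb⟩ := IsLocalization.exist_integer_multiples_of_finite (nonZeroDivisors (𝓞 K))
    (fun p : Fin n × Fin n => X p.1 p.2)
  choose y hy using hb
  obtain ⟨m, hm, t, ht⟩ := RingOfIntegers.exists_dvd_natCast
    (mul_ne_zero hc0 (nonZeroDivisors.coe_ne_zero b))
  refine ⟨m, hm, ?_⟩
  obtain ⟨a, ha⟩ := (hγ.mem_range _).2
    ⟨Matrix.of fun i j => c * (t * y (i, j)), fun i j => I.mul_mem_right _ hc, rfl⟩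
  refine ⟨a, ?_⟩
  rw [ha]
  ext i j
  have h1 := hy (i, j)
  simp only [Algebra.smul_def] at h1
  have h2 : (m : K) = algebraMap (𝓞 K) K c * algebraMap (𝓞 K) K b * algebraMap (𝓞 K) K t := by
    rw [← map_mul, ← map_mul, ← ht, map_natCast]
  simp only [matrixInclusion, RingHom.mapMatrix_apply, Matrix.map_apply, Matrix.of_apply, map_mul,
    Matrix.smul_apply, nsmul_eq_mul, h1, h2]
  ring

theorem toEnd_apply (s : leftRegular (Matrix (Fin n) (Fin n) (𝓞 K))) (a : A) :
    γ.j (σ.toEnd s a) = matrixInclusion K n s * γ.j a := by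
  rw [← γ.act_ι, hγ.act_apply, hγ.ι_eq, coe_leftRegularToGL]

/-- Preimages keep the exponent `m`. For images under `s`, the denominator of `s⁻¹` enters: some `p
• s⁻¹` is integral, so `p • a` is in the image of `s`. -/
theorem exists_nsmul_mem (C : σ.Constr) : ∃ m : ℕ, m ≠ 0 ∧ ∀ a, m • a ∈ C.1 := by
  obtain ⟨C, hC⟩ := C
  induction hC with
  | top => exact ⟨1, one_ne_zero, fun _ => trivial⟩
  | @map s C _ ih =>
    obtain ⟨m, hm, ih⟩ := ih
    obtain ⟨p, hp, c, hc⟩ := hγ.exists_nsmul_eq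
      ((leftRegularToGL K n s)⁻¹ : GL (Fin n) K).1
    obtain ⟨Y, -, hY⟩ := hγ.exists_eq c
    refine ⟨m * p, mul_ne_zero hm hp, fun a => ?_⟩
    obtain ⟨b, hb⟩ := hγ.exists_j_eq_mul Y a
    refine ⟨m • b, ih b, ?_⟩
    refine (map_nsmul (σ.toEnd s) m b).trans ?_
    rw [mul_nsmul']
    congr 1
    apply γ.j_injective
    rw [hγ.toEnd_apply, hb, hY, ← hc, ← mul_assoc, mul_smul_comm, ← coe_leftRegularToGL,
      ← Units.val_mul, mul_inv_cancel, Units.val_one, smul_mul_assoc, one_mul, map_nsmul]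
  | @comap s C _ ih =>
    obtain ⟨m, hm, ih⟩ := ih
    refine ⟨m, hm, fun a => ?_⟩
    have h : σ.toEnd s (m • a) ∈ C := by rw [map_nsmul]; exact ih _
    exact h

/-- The scalar matrix `m` is left regular, so `m • A` is itself constructible. -/
theorem exists_constr_nsmul {m : ℕ} (hm : m ≠ 0) :
    ∃ D : σ.Constr, ∀ d ∈ D.1, ∃ a, d = m • a := by
  have hs : (m : Matrix (Fin n) (Fin n) (𝓞 K)) ∈ leftRegular (Matrix (Fin n) (Fin n) (𝓞 K)) := by
    intro Y Z h
    simp only [← nsmul_eq_mul] at h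
    ext i j
    have := congrFun (congrFun h i) j
    simp only [Matrix.smul_apply, nsmul_eq_mul] at this
    exact congrArg _ (mul_left_cancel₀ (Nat.cast_ne_zero.2 hm) this)
  refine ⟨⟨_, .map ⟨_, hs⟩ .top⟩, ?_⟩
  rintro _ ⟨a, -, rfl⟩
  refine ⟨a, γ.j_injective ?_⟩
  have := hγ.toEnd_apply ⟨_, hs⟩ a
  rw [map_nsmul, nsmul_eq_mul, ← map_natCast (matrixInclusion K n)]
  exact this

theorem eq_zero_of_forall_mem {a : A} (h : ∀ C : σ.Constr, a ∈ C.1) : a = 0 := by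
  obtain ⟨Y, -, hY⟩ := hγ.exists_eq a
  have h0 : Y = 0 := by
    ext i j
    refine congrArg _ (RingOfIntegers.eq_zero_of_forall_natCast_dvd fun m hm => ?_)
    obtain ⟨D, hD⟩ := hγ.exists_constr_nsmul hm
    obtain ⟨b, hb⟩ := hD a (h D)
    obtain ⟨Z, -, hZ⟩ := hγ.exists_eq b
    have : Y = m • Z := matrixInclusion_injective K n (by
      rw [hY, hb, map_nsmul, map_nsmul, hZ])
    exact ⟨Z i j, by rw [this, Matrix.smul_apply, nsmul_eq_mul]⟩
  apply γ.j_injective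
  rw [← hY, h0, map_zero, map_zero]

theorem toCompletion_injective : Function.Injective σ.toCompletion := by
  intro a b h
  rw [← sub_eq_zero]
  refine hγ.eq_zero_of_forall_mem fun C => ?_
  have : (b : A ⧸ C.1) = a := congrFun (congrArg Subtype.val h.symm) C
  rw [sub_eq_neg_add]
  exact QuotientAddGroup.eq.1 this

theorem finite_module : Module.Finite ℤ A := by
  let N := LinearMap.range (matrixInclusion K n).toAddMonoidHom.toIntLinearMap
  let f : A →ₗ[ℤ] N := γ.j.toIntLinearMap.codRestrict N fun a => by
    obtain ⟨Y, -, hY⟩ := hγ.exists_eq a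
    exact ⟨Y, hY⟩
  have hf : Function.Injective f := fun a b h => γ.j_injective (congrArg Subtype.val h)
  have := isNoetherian_of_injective f hf
  infer_instance

theorem fg : AddGroup.FG A :=
  have := hγ.finite_module
  Module.Finite.iff_addGroup_fg.1 this

/-- The quotients by constructible subgroups are finitely generated and of bounded exponent, hence
finite. -/
theorem compactSpace : CompactSpace σ.Completion := by
  refine Completion.compactSpace fun C => ?_
  have := hγ.finite_module
  have h1 : Module.Finite ℤ (A ⧸ C.1) :=
    Module.Finite.of_surjective (QuotientAddGroup.mk' C.1).toIntLinearMap
      QuotientAddGroup.mk_surjective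
  obtain ⟨m, hm, h⟩ := hγ.exists_nsmul_mem C
  refine Module.finite_of_fg_torsion (A ⧸ C.1) fun {x} => ?_
  obtain ⟨a, rfl⟩ := QuotientAddGroup.mk_surjective x
  refine ⟨⟨m, mem_nonZeroDivisors_of_ne_zero (Nat.cast_ne_zero.2 hm)⟩, ?_⟩
  have : ((m • a : A) : A ⧸ C.1) = 0 := (QuotientAddGroup.eq_zero_iff _).2 (h a)
  rw [Submonoid.mk_smul, natCast_zsmul]
  exact this

end IsMatrixLattice

end Globalization

/-! ### Commuting displacements over rings of integers -/

section MatrixDisplacements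

open NumberField

/-- Modulo a maximal ideal not containing `k`, the `P a` are invertible and the `U a` exhaust all
matrices, so the field case gives `P a ≡ k`. Multiplying by `k` takes care of the remaining maximal
ideals, and an element of all maximal ideals is zero. -/
theorem Matrix.eq_natCast_of_commuting_displacements {K : Type u} [Field K] [NumberField K]
    {n : Type*} [Fintype n] [DecidableEq n] {ι : Type*} {k : ℕ} (hk : k ≠ 0)
    {P U : ι → Matrix n n (𝓞 K)} (hc : ∀ a b, (P a - k) * U b = (P b - k) * U a)
    (hP : ∀ a, ∃ b, P a * P b = k * k)
    (hU : ∀ p : Ideal (𝓞 K), p.IsMaximal → (k : 𝓞 K) ∉ p → ∀ V : Matrix n n (𝓞 K),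
      ∃ a, ∀ i j, U a i j - V i j ∈ p) (a : ι) : P a = k := by
  have key (p : Ideal (𝓞 K)) (hp : p.IsMaximal) (hkp : (k : 𝓞 K) ∉ p) (i j : n) :
      (P a - k) i j ∈ p := by
    let _ := Ideal.Quotient.field p
    let q : Matrix n n (𝓞 K) →+* Matrix n n (𝓞 K ⧸ p) := (Ideal.Quotient.mk p).mapMatrix
    have hkF : (k : 𝓞 K ⧸ p) ≠ 0 := by
      rw [← map_natCast (Ideal.Quotient.mk p)]
      exact fun h => hkp (Ideal.Quotient.eq_zero_iff_mem.1 h)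
    have hkM : IsUnit (k : Matrix n n (𝓞 K ⧸ p)) := by
      rw [← map_natCast (algebraMap (𝓞 K ⧸ p) (Matrix n n (𝓞 K ⧸ p)))]
      exact (IsUnit.mk0 _ hkF).map _
    have h0 : q (P a - k) = 0 := by
      refine Matrix.eq_zero_of_commuting_displacements (k := k) (Q := fun a => q (P a - k))
        (u := fun a => q (U a)) ?_ (fun a b => ?_) (fun a => ?_) a
      · intro v
        choose V hV using fun i j => Ideal.Quotient.mk_surjective (v i j)
        obtain rfl : q (Matrix.of V) = v := Matrix.ext hV
        obtain ⟨b, hb⟩ := hU p hp hkp (Matrix.of V)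
        exact ⟨b, Matrix.ext fun i j => Ideal.Quotient.eq.2 (hb i j)⟩
      · rw [← map_mul, ← map_mul, hc]
      · obtain ⟨b, hb⟩ := hP a
        rw [map_sub, map_natCast, add_sub_cancel]
        have h2 := congrArg q hb
        rw [map_mul, map_mul, map_natCast] at h2
        have h3 : IsUnit (q (P a) * q (P b)) := h2 ▸ hkM.mul hkM
        rw [Matrix.isUnit_iff_isUnit_det, Matrix.det_mul] at h3
        exact (Matrix.isUnit_iff_isUnit_det _).2 (isUnit_of_mul_isUnit_left h3)
    exact Ideal.Quotient.eq_zero_iff_mem.1 (congrFun (congrFun h0 i) j)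
  rw [← sub_eq_zero]
  refine Matrix.ext fun i j => ?_
  have h1 : (k : 𝓞 K) * (P a - k) i j = 0 := by
    refine RingOfIntegers.eq_zero_of_forall_mem_isMaximal fun p hp => ?_
    by_cases hkp : (k : 𝓞 K) ∈ p
    · exact p.mul_mem_right _ hkp
    · exact p.mul_mem_left _ (key p hp hkp i j)
  exact (mul_eq_zero.1 h1).resolve_left (Nat.cast_ne_zero.2 hk)

end MatrixDisplacements

/-! ### The cocycle near the origin has trivial linear part -/

namespace OrbitCocycle

open NumberField AlgebraicAction Globalization

variable {S₁ : Type u} {A₁ : Type v} [Monoid S₁] [AddCommGroup A₁] {σ₁ : AlgebraicAction S₁ A₁}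
  {T₁ : Type w} {B₁ : Type x} [Group T₁] [AddCommGroup B₁] {γ₁ : Globalization σ₁ T₁ B₁}

section

variable {S₂ : Type u'} {A₂ : Type v'} [Monoid S₂] [AddCommGroup A₂] {σ₂ : AlgebraicAction S₂ A₂}
  {T₂ : Type w'} {B₂ : Type x'} [Group T₂] [AddCommGroup B₂] {γ₂ : Globalization σ₂ T₂ B₂}
  (Θ : OrbitCocycle γ₁ γ₂)

/-- The cocycle at the origin, restricted to translations. -/
def atZero (a : A₁) : γ₂.AffineGroup := Θ.val (γ₁.translation (γ₁.j a)) (σ₁.toCompletion 0)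

/-- The restriction of the cocycle to translations depends only on the class of the point modulo
`C`. -/
def IsUniform (C : σ₁.Constr) : Prop :=
  ∀ (a : A₁) (x x' : σ₁.Completion), x.1 C = x'.1 C →
    Θ.val (γ₁.translation (γ₁.j a)) x = Θ.val (γ₁.translation (γ₁.j a)) x'

/-- The image of the origin need not lie in `A₂`. The nearby lattice point `b` serves as base point
instead, so that displacements become lattice elements. -/
theorem exists_constr (C : σ₁.Constr) : ∃ (D : σ₂.Constr) (b : A₂), ∀ w : A₂,
    (w : A₂ ⧸ D.1) = b → (Θ.obj.symm (σ₂.toCompletion w)).1 C = 0 := by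
  have h : {x : σ₁.Completion | x.1 C ∈ ({0} : Set (A₁ ⧸ C.1))} ∈
      𝓝 (Θ.obj.symm (Θ.obj (σ₁.toCompletion 0))) := by
    rw [Homeomorph.symm_apply_apply]
    exact (Completion.isOpen_cylinder C {0}).mem_nhds rfl
  obtain ⟨D, hD⟩ := Completion.exists_cylinder (Θ.obj.symm.continuous.continuousAt h)
  obtain ⟨b, hb⟩ := (Θ.obj (σ₁.toCompletion 0)).exists_rep D
  exact ⟨D, b, fun w hw => hD (σ₂.toCompletion w) (hw.trans hb)⟩

/-- The orbit of a point near the image of the origin is dense near the image of the origin. -/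
theorem exists_approx {C : σ₁.Constr} {b w : A₂} (hb : (Θ.obj.symm (σ₂.toCompletion b)).1 C = 0)
    (hw : (Θ.obj.symm (σ₂.toCompletion w)).1 C = 0) (E : σ₂.Constr) :
    ∃ a ∈ C.1, (Θ.obj ((Θ.obj.symm (σ₂.toCompletion b)).translate a)).1 E = (w : A₂ ⧸ E.1) := by
  have h : {y : σ₂.Completion | y.1 E ∈ ({(w : A₂ ⧸ E.1)} : Set (A₂ ⧸ E.1))} ∈
      𝓝 (Θ.obj (Θ.obj.symm (σ₂.toCompletion w))) := by
    rw [Homeomorph.apply_symm_apply]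
    exact (Completion.isOpen_cylinder E _).mem_nhds rfl
  obtain ⟨D, hD⟩ := Completion.exists_cylinder (Θ.obj.continuous.continuousAt h)
  let D' : σ₁.Constr := ⟨D.1 ⊓ C.1, D.2.inf C.2⟩
  obtain ⟨a₁, h₁⟩ := (Θ.obj.symm (σ₂.toCompletion w)).exists_rep D'
  obtain ⟨a₂, h₂⟩ := (Θ.obj.symm (σ₂.toCompletion b)).exists_rep D'
  have h₁' := Completion.eq_of_le _ (D := C) inf_le_right h₁
  have h₂' := Completion.eq_of_le _ (D := C) inf_le_right h₂
  rw [hw, QuotientAddGroup.eq_zero_iff] at h₁'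
  rw [hb, QuotientAddGroup.eq_zero_iff] at h₂'
  refine ⟨a₁ - a₂, C.1.sub_mem h₁' h₂', hD _ ?_⟩
  change (Θ.obj.symm (σ₂.toCompletion b)).1 D + ((a₁ - a₂ : A₁) : A₁ ⧸ D.1) = _
  rw [← Completion.eq_of_le _ (D := D) inf_le_left h₁,
    ← Completion.eq_of_le _ (D := D) inf_le_left h₂, ← QuotientAddGroup.mk_add,
    add_sub_cancel]

variable {Θ} {C : σ₁.Constr} (hC : Θ.IsUniform C)

include hC

theorem IsUniform.val_eq {x : σ₁.Completion} (hx : x.1 C = 0) (a : A₁) :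
    Θ.val (γ₁.translation (γ₁.j a)) x = Θ.atZero a :=
  hC a _ _ hx

/-- Translating the origin by `b ∈ C` stays in the zero class, where the cocycle takes the same
values. -/
theorem IsUniform.atZero_add (a : A₁) {b : A₁} (hb : b ∈ C.1) :
    Θ.atZero (a + b) = Θ.atZero a * Θ.atZero b := by
  rw [atZero, val_translation_add, Completion.translate_toCompletion, zero_add, hC.val_eq]
  · rfl
  · exact (QuotientAddGroup.eq_zero_iff b).2 hb

theorem IsUniform.graph {x : σ₁.Completion} (hx : x.1 C = 0) (a : A₁) :
    (Θ.obj x, Θ.obj (x.translate a)) ∈ γ₂.graph (Θ.atZero a) := by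
  rw [← hC.val_eq hx]
  exact Θ.graph (graph_translation x a)

end

section

variable {K : Type u'} [Field K] [NumberField K] {n : ℕ} {A₂ : Type v'} [AddCommGroup A₂]
  {σ₂ : AlgebraicAction (leftRegular (Matrix (Fin n) (Fin n) (𝓞 K))) A₂}
  {γ₂ : Globalization σ₂ (GL (Fin n) K) (Matrix (Fin n) (Fin n) K)} {I : Ideal (𝓞 K)}
  {Θ : OrbitCocycle γ₁ γ₂} {C : σ₁.Constr}

/-- The elements of `C` act near the base point `b` by commuting affine maps. The integral matrices
`U a` are the displacements of `b`, and `P a` is the linear part of `Θ.atZero a` multiplied by `k₀ *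
i` to make it integral. -/
theorem IsUniform.right_atZero (hC : Θ.IsUniform C) (hγ : γ₂.IsMatrixLattice I) {a : A₁}
    (ha : a ∈ C.1) : (Θ.atZero a).right = 1 := by
  obtain ⟨D, b, hD⟩ := Θ.exists_constr C
  have move (a : A₁) (w : A₂) (hw : (w : A₂ ⧸ D.1) = b) : ∃ w',
      γ₂.affine (Θ.atZero a) (γ₂.j w) = γ₂.j w' ∧
        Θ.obj ((Θ.obj.symm (σ₂.toCompletion w)).translate a) = σ₂.toCompletion w' := by
    have h := hC.graph (hD w hw) a
    rw [Homeomorph.apply_symm_apply] at h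
    exact exists_of_graph_toCompletion h
  -- `k₀ • A₂` lies in `D`, and the scalar matrix `i` lies in the lattice.
  obtain ⟨k₀, hk₀, hkD⟩ := hγ.exists_nsmul_mem D
  obtain ⟨i, hi, e, he⟩ := hγ.exists_nsmul_eq 1
  have hbD (f : A₂) : ((b + k₀ • f : A₂) : A₂ ⧸ D.1) = b := by
    rw [QuotientAddGroup.mk_add, (QuotientAddGroup.eq_zero_iff _).2 (hkD f), add_zero]
  choose b' hb' hb'' using fun a => move a b rfl
  choose U _ hU using fun a => hγ.exists_eq (b' a - b)
  -- Comparing the images of `b + k₀ • e` and `b` isolates the linear part applied to the scalar `k₀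
  -- * i`.
  have hP (a : A₁) : ∃ P, matrixInclusion K n P = (k₀ * i) • (Θ.atZero a).right.1 := by
    obtain ⟨w', hw', -⟩ := move a _ (hbD e)
    obtain ⟨P, -, hP⟩ := hγ.exists_eq (w' - b' a)
    refine ⟨P, ?_⟩
    rw [hP, map_sub, ← hw', ← hb', map_add, affine_add, add_sub_cancel_left, hγ.act_apply,
      map_nsmul, ← he, mul_smul_comm, mul_smul_comm, mul_one, mul_nsmul']
  choose P hP using hP
  have hinj := matrixInclusion_injective K n
  have hk : k₀ * i ≠ 0 := mul_ne_zero hk₀ hi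
  have hPk : P a = (k₀ * i : ℕ) := by
    refine Matrix.eq_natCast_of_commuting_displacements (ι := C.1) hk (P := fun a => P a)
      (U := fun a => U a) (fun a c => hinj ?_) (fun a => ⟨-a, hinj ?_⟩) (fun p hp hkp V => ?_)
      ⟨a, ha⟩
    · have hcomm : Θ.atZero a * Θ.atZero c = Θ.atZero c * Θ.atZero a := by
        rw [← hC.atZero_add _ c.2, ← hC.atZero_add _ a.2, add_comm]
      have h := act_displacement hcomm (γ₂.j b)
      rw [hb', hb', ← map_sub, ← map_sub, hγ.act_apply, hγ.act_apply, ← hU, ← hU] at h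
      simp only [map_mul, map_sub, map_natCast, hP, sub_mul, smul_mul_assoc]
      rw [← nsmul_eq_mul, ← nsmul_eq_mul, ← nsmul_sub, ← nsmul_sub, h]
    · have h : (Θ.atZero (a + -a)).right = 1 := by
        rw [add_neg_cancel, atZero, map_zero, translation_zero, val_one]; rfl
      rw [hC.atZero_add _ (C.1.neg_mem a.2), SemidirectProduct.mul_right] at h
      simp only [map_mul, map_natCast, AddSubgroup.coe_neg, hP]
      rw [smul_mul_smul_comm, ← Units.val_mul, h, Units.val_one, nsmul_eq_mul, mul_one]
      push_cast
      rfl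
    -- With `t` inverse to `k₀ * i` modulo `p`, moving `b` to `b + k₀ • f` is a displacement by `k₀
    -- * i * t * V ≡ V`. The orbit approximates this target modulo multiples of the norm of `p`,
    -- which lies in `p`.
    · obtain ⟨t, ht⟩ : ∃ t, ((k₀ * i : ℕ) : 𝓞 K) * t - 1 ∈ p := by
        let _ := Ideal.Quotient.field p
        obtain ⟨t, ht⟩ := Ideal.Quotient.mk_surjective
          ((Ideal.Quotient.mk p ((k₀ * i : ℕ) : 𝓞 K))⁻¹)
        refine ⟨t, Ideal.Quotient.eq.1 ?_⟩
        rw [map_mul, ht, map_one, mul_inv_cancel₀]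
        exact fun h => hkp (Ideal.Quotient.eq_zero_iff_mem.1 h)
      have hp0 : p ≠ ⊥ := Ring.ne_bot_of_isMaximal_of_not_isField hp
        (RingOfIntegers.not_isField K)
      obtain ⟨E, hE⟩ := hγ.exists_constr_nsmul (m := Ideal.absNorm p)
        (fun h => hp0 (Ideal.absNorm_eq_zero_iff.1 h))
      obtain ⟨f, hf⟩ := hγ.exists_j_eq_mul (t • V) e
      obtain ⟨c, hc, hcw⟩ := Θ.exists_approx (hD b rfl) (hD _ (hbD f)) E
      rw [hb''] at hcw
      obtain ⟨d, hd⟩ := hE _ (QuotientAddGroup.eq.1 hcw.symm)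
      obtain ⟨Z, -, hZ⟩ := hγ.exists_eq d
      have hUc : U c = (k₀ * i) • (t • V) + Ideal.absNorm p • Z := hinj (by
        rw [map_add, map_nsmul, map_nsmul, hZ, hU, ← map_nsmul γ₂.j, ← hd, map_add, map_neg, map_add,
          map_nsmul, hf, ← he, map_sub]
        simp only [mul_smul_comm, mul_one, mul_nsmul']
        abel)
      refine ⟨⟨c, hc⟩, fun i' j' => ?_⟩
      have h2 : U c i' j' - V i' j' = (((k₀ * i : ℕ) : 𝓞 K) * t - 1) * V i' j' +
          (Ideal.absNorm p : 𝓞 K) * Z i' j' := by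
        rw [hUc]
        rw [Matrix.add_apply, Matrix.smul_apply, Matrix.smul_apply, Matrix.smul_apply,
          nsmul_eq_mul, nsmul_eq_mul, smul_eq_mul]
        ring
      change U c i' j' - V i' j' ∈ p
      rw [h2]
      exact p.add_mem (p.mul_mem_right _ ht) (p.mul_mem_right _ (Ideal.absNorm_mem p))
  have h := hP a
  rw [hPk, map_natCast, ← nsmul_one] at h
  refine Units.ext (Matrix.ext fun i' j' => ?_)
  have h2 := congrFun (congrFun h i') j'
  rw [Matrix.smul_apply, Matrix.smul_apply] at h2
  exact (nsmul_right_injective hk h2).symm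

end

end OrbitCocycle

/-! ### From the cocycle to a linear map of matrix algebras -/

/-- Every `X` has a multiple `m • X` in `j(C)`, and `m⁻¹ • r (m • X)` does not depend on the choice
of `m`. -/
theorem AddMonoidHom.exists_rat_linearMap {A B B' : Type*} [AddCommGroup A] [AddCommGroup B]
    [Module ℚ B] [AddCommGroup B'] [Module ℚ B'] {j : A →+ B} (hj : Function.Injective j)
    {C : AddSubgroup A} (hC : ∀ X : B, ∃ m : ℕ, m ≠ 0 ∧ ∃ a ∈ C, m • X = j a) (r : C →+ B') :
    ∃ f : B →ₗ[ℚ] B', ∀ a : C, f (j a) = r a := by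
  choose m hm a ha hma using hC
  have key {X : B} {k : ℕ} (hk : k ≠ 0) {b : C} (h : k • X = j b) :
      ((m X : ℚ)⁻¹ • r ⟨a X, ha X⟩ : B') = (k : ℚ)⁻¹ • r b := by
    have h1 : m X • b = k • ⟨a X, ha X⟩ := Subtype.ext (hj (by
      push_cast
      rw [map_nsmul, map_nsmul, ← h, ← hma, nsmul_left_comm]))
    have h2 := congrArg r h1
    rw [map_nsmul, map_nsmul, ← Nat.cast_smul_eq_nsmul ℚ, ← Nat.cast_smul_eq_nsmul ℚ] at h2
    have hk' : (k : ℚ) ≠ 0 := Nat.cast_ne_zero.2 hk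
    have hm' : (m X : ℚ) ≠ 0 := Nat.cast_ne_zero.2 (hm X)
    rw [inv_smul_eq_iff₀ hm', smul_comm, h2, inv_smul_smul₀ hk']
  let f : B →+ B' :=
    AddMonoidHom.mk' (fun X => (m X : ℚ)⁻¹ • r ⟨a X, ha X⟩) fun X Y => by
      have hX : (m X * m Y) • X = j (m Y • (⟨a X, ha X⟩ : C) : C) := by
        push_cast
        rw [map_nsmul, ← hma, mul_nsmul]
      have hY : (m X * m Y) • Y = j (m X • (⟨a Y, ha Y⟩ : C) : C) := by
        push_cast
        rw [map_nsmul, ← hma, mul_nsmul']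
      have hXY : (m X * m Y) • (X + Y) =
          j (m Y • (⟨a X, ha X⟩ : C) + m X • (⟨a Y, ha Y⟩ : C) : C) := by
        rw [AddSubgroup.coe_add, map_add, ← hX, ← hY, nsmul_add]
      have h0 := mul_ne_zero (hm X) (hm Y)
      change _ = (m X : ℚ)⁻¹ • r ⟨a X, ha X⟩ + (m Y : ℚ)⁻¹ • r ⟨a Y, ha Y⟩
      rw [key h0 hX, key h0 hY, key h0 hXY, map_add, smul_add]
  refine ⟨f.toRatLinearMap, fun b => ?_⟩
  have := key (X := j b) one_ne_zero (one_nsmul _)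
  rwa [Nat.cast_one, inv_one, one_smul] at this

open NumberField AlgebraicAction Globalization

theorem Globalization.IsMatrixLattice.exists_nsmul_eq_mem {K : Type u} [Field K] [NumberField K]
    {n : ℕ} {A : Type v} [AddCommGroup A]
    {σ : AlgebraicAction (leftRegular (Matrix (Fin n) (Fin n) (𝓞 K))) A}
    {γ : Globalization σ (GL (Fin n) K) (Matrix (Fin n) (Fin n) K)} {I : Ideal (𝓞 K)}
    (hγ : γ.IsMatrixLattice I) (C : σ.Constr) (X : Matrix (Fin n) (Fin n) K) :
    ∃ m : ℕ, m ≠ 0 ∧ ∃ a ∈ C.1, m • X = γ.j a := by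
  obtain ⟨m, hm, a, ha⟩ := hγ.exists_nsmul_eq X
  obtain ⟨k, hk, h⟩ := hγ.exists_nsmul_mem C
  exact ⟨m * k, mul_ne_zero hm hk, k • a, h a, by rw [mul_nsmul, ha, map_nsmul]⟩

namespace OrbitCocycle

variable {K : Type u} [Field K] [NumberField K] {n : ℕ} {A : Type v} [AddCommGroup A]
  {σ : AlgebraicAction (leftRegular (Matrix (Fin n) (Fin n) (𝓞 K))) A}
  {γ : Globalization σ (GL (Fin n) K) (Matrix (Fin n) (Fin n) K)} {I : Ideal (𝓞 K)}
  {K' : Type u'} [Field K'] [NumberField K'] {n' : ℕ} {A' : Type v'} [AddCommGroup A']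
  {σ' : AlgebraicAction (leftRegular (Matrix (Fin n') (Fin n') (𝓞 K'))) A'}
  {γ' : Globalization σ' (GL (Fin n') K') (Matrix (Fin n') (Fin n') K')} {I' : Ideal (𝓞 K')}
  {Θ : OrbitCocycle γ γ'} {C : σ.Constr}

theorem IsUniform.atZero_eq_translation (hC : Θ.IsUniform C) (hγ' : γ'.IsMatrixLattice I') {a : A}
    (ha : a ∈ C.1) : Θ.atZero a = γ'.translation (Θ.atZero a).left.toAdd :=
  eq_translation (hC.right_atZero hγ' ha)

/-- The translation parts of the cocycle at the origin, on a subgroup of translations on which the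
cocycle depends only on the class of the point modulo this subgroup. -/
def IsUniform.transfer (hC : Θ.IsUniform C) (hγ' : γ'.IsMatrixLattice I') :
    C.1 →+ Matrix (Fin n') (Fin n') K' :=
  AddMonoidHom.mk' (fun a => (Θ.atZero a).left.toAdd) fun a b => by
    apply translation_injective (γ := γ')
    rw [translation_add, ← hC.atZero_eq_translation hγ' a.2, ← hC.atZero_eq_translation hγ' b.2,
      ← hC.atZero_eq_translation hγ' (a + b).2]
    exact hC.atZero_add _ b.2

theorem IsUniform.translation_transfer (hC : Θ.IsUniform C) (hγ' : γ'.IsMatrixLattice I')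
    (a : C.1) : γ'.translation (hC.transfer hγ' a) = Θ.atZero a :=
  (hC.atZero_eq_translation hγ' a.2).symm

/-- If the cocycle value is trivial, then the origin and its translate by `a` have the same image
under the homeomorphism, and `A` embeds in its completion. -/
theorem IsUniform.transfer_injective (hC : Θ.IsUniform C) (hγ : γ.IsMatrixLattice I)
    (hγ' : γ'.IsMatrixLattice I') : Function.Injective (hC.transfer hγ') := by
  rw [injective_iff_map_eq_zero]
  intro a ha
  have h := hC.translation_transfer hγ' a
  rw [ha, translation_zero] at h
  have h1 := Θ.graph (graph_translation (γ := γ) (σ.toCompletion 0) a)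
  change _ ∈ γ'.graph (Θ.atZero a.1) at h1
  rw [← h] at h1
  have h2 := graph_unique (graph_one _) h1
  rw [Completion.translate_toCompletion] at h2
  have h3 := hγ.toCompletion_injective (Θ.obj.injective h2)
  rw [zero_add] at h3
  exact Subtype.ext h3.symm

/-- The transfer intertwines the linear actions near zero. -/
theorem IsUniform.exists_transfer_act (hC : Θ.IsUniform C) (hγ' : γ'.IsMatrixLattice I')
    (s : GL (Fin n) K) : ∃ τ : GL (Fin n') K', ∃ D : σ.Constr, D.1 ≤ C.1 ∧
      ∀ a : C.1, a.1 ∈ D.1 → ∃ c : C.1, γ.act s (γ.j a) = γ.j c ∧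
        hC.transfer hγ' c = γ'.act τ (hC.transfer hγ' a) := by
  let g : γ.AffineGroup := SemidirectProduct.inr s
  have hg (b : Matrix (Fin n) (Fin n) K) : γ.affine g b = γ.act s b := by simp [affine, g]
  have hg0 : (σ.toCompletion 0, σ.toCompletion 0) ∈ γ.graph g :=
    graph_toCompletion (by rw [hg, map_zero, map_zero])
  obtain ⟨E, hE⟩ := Completion.exists_cylinder (Θ.eventually_eq ⟨_, hg0⟩)
  obtain ⟨D, hD⟩ := Globalization.exists_constr (γ := γ) s C
  -- `τ` is the linear part of the cocycle of `g` at its fixed point. `D` keeps `s` applied to `a`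
  -- inside `C`, and `E` keeps the cocycle of `g` constant.
  refine ⟨(Θ.val g (σ.toCompletion 0)).right, ⟨C.1 ⊓ (D.1 ⊓ E.1), C.2.inf (D.2.inf E.2)⟩,
    inf_le_left, fun a ha => ?_⟩
  obtain ⟨c, hc, hac⟩ := hD a ha.2.1
  refine ⟨⟨c, hc⟩, hac, ?_⟩
  -- The cocycle is computed along both factorizations of one affine map: translate by `a` and then
  -- apply `g`, or apply `g` and then translate by `c`.
  have h1 := Θ.mul (graph_translation (γ := γ) (σ.toCompletion 0) a.1)
    (h := g) ⟨σ.toCompletion c, by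
      rw [Completion.translate_toCompletion, zero_add]
      exact graph_toCompletion (by rw [hg, hac])⟩
  have h2 := Θ.mul hg0 ⟨_, graph_translation (γ := γ) _ c⟩
  have h3 : Θ.val g ((σ.toCompletion 0).translate a.1) = Θ.val g (σ.toCompletion 0) := by
    refine hE _ ?_
    rw [Completion.translate_toCompletion, zero_add]
    exact (QuotientAddGroup.eq_zero_iff a.1).2 ha.2.2
  have h4 : γ.translation (γ.j c) * g = g * γ.translation (γ.j a) := by
    rw [mul_translation]
    congr 2
    exact hac.symm
  rw [h4, h1, h3] at h2
  change _ * Θ.atZero a = Θ.atZero c * _ at h2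
  rw [← hC.translation_transfer hγ' a, ← hC.translation_transfer hγ' ⟨c, hc⟩,
    mul_translation] at h2
  exact (translation_injective (mul_right_cancel h2)).symm

/-- An orbit cocycle induces an injective linear map of matrix algebras that intertwines the
actions of the general linear groups. -/
theorem exists_linearMap (Θ : OrbitCocycle γ γ') (hγ : γ.IsMatrixLattice I)
    (hγ' : γ'.IsMatrixLattice I') :
    ∃ f : Matrix (Fin n) (Fin n) K →ₗ[ℚ] Matrix (Fin n') (Fin n') K', Function.Injective f ∧
      ∀ s : GL (Fin n) K, ∃ τ : GL (Fin n') K', ∀ X, f (s.1 * X) = τ.1 * f X := by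
  have := hγ.compactSpace
  have := hγ.fg
  obtain ⟨C, hC⟩ := Θ.exists_uniform
  have hC : Θ.IsUniform C := hC
  obtain ⟨f, hf⟩ := AddMonoidHom.exists_rat_linearMap γ.j_injective (hγ.exists_nsmul_eq_mem C)
    (hC.transfer hγ')
  refine ⟨f, (injective_iff_map_eq_zero f).2 fun X hX => ?_, fun s => ?_⟩
  · obtain ⟨m, hm, a, ha, h⟩ := hγ.exists_nsmul_eq_mem C X
    have h1 := hf ⟨a, ha⟩
    rw [← h, map_nsmul, hX, smul_zero] at h1
    have h2 : a = 0 := congrArg Subtype.val ((injective_iff_map_eq_zero _).1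
      (hC.transfer_injective hγ hγ') ⟨a, ha⟩ h1.symm)
    rw [h2, map_zero, ← Nat.cast_smul_eq_nsmul ℚ] at h
    exact (smul_eq_zero.1 h).resolve_left (Nat.cast_ne_zero.2 hm)
  · obtain ⟨τ, D, hDC, hD⟩ := hC.exists_transfer_act hγ' s
    refine ⟨τ, fun X => ?_⟩
    obtain ⟨m, hm, a, ha, h⟩ := hγ.exists_nsmul_eq_mem D X
    obtain ⟨c, hac, hc⟩ := hD ⟨a, hDC ha⟩ ha
    rw [hγ.act_apply, ← h, mul_smul_comm] at hac
    have h1 := hf c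
    rw [← hac, hc, ← hf, ← h, hγ'.act_apply, map_nsmul, map_nsmul, mul_smul_comm,
      ← Nat.cast_smul_eq_nsmul ℚ, ← Nat.cast_smul_eq_nsmul ℚ] at h1
    exact smul_right_injective _ (Nat.cast_ne_zero.2 hm) h1

end OrbitCocycle

/-! ### Matrix algebras -/

section MatrixAlgebras

variable {K : Type u} [Field K] {n : ℕ} {K' : Type u'} [Field K'] {n' : ℕ}

/-- Every matrix is a difference of a natural scalar and an invertible matrix, because its spectrum
is finite and the characteristic is zero. -/
theorem Matrix.exists_mul_of_forall_GL [CharZero K] [CharZero K']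
    (f : Matrix (Fin n) (Fin n) K →ₗ[ℚ] Matrix (Fin n') (Fin n') K')
    (hf : ∀ s : GL (Fin n) K, ∃ τ : GL (Fin n') K', ∀ X, f (s.1 * X) = τ.1 * f X)
    (M : Matrix (Fin n) (Fin n) K) : ∃ P, ∀ X, f (M * X) = P * f X := by
  obtain ⟨_, ⟨c, rfl⟩, hc⟩ := (Set.infinite_range_of_injective
    (Nat.cast_injective (R := K))).exists_notMem_finite M.finite_spectrum
  have hu : IsUnit (algebraMap K (Matrix (Fin n) (Fin n) K) c - M) := spectrum.notMem_iff.1 hc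
  obtain ⟨τ, hτ⟩ := hf hu.unit
  refine ⟨c - τ.1, fun X => ?_⟩
  have h := hτ X
  rw [IsUnit.unit_spec, map_natCast, sub_mul, map_sub, ← nsmul_eq_mul, map_nsmul] at h
  rw [sub_mul, ← h, ← nsmul_eq_mul, sub_sub_cancel]

variable [NumberField K] [NumberField K']

/-- With `f e = 1`, the multiplier of `f` attached to `M` must be `f (M * e)`, and multipliers
compose multiplicatively. Normalizing by `e` is needed since `f 1` need not be 1. -/
theorem Matrix.nonempty_algEquiv_of_linearMap
    (f : Matrix (Fin n) (Fin n) K →ₗ[ℚ] Matrix (Fin n') (Fin n') K') (hf : Function.Injective f)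
    (hfs : ∀ s : GL (Fin n) K, ∃ τ : GL (Fin n') K', ∀ X, f (s.1 * X) = τ.1 * f X)
    (hdim : Module.finrank ℚ (Matrix (Fin n) (Fin n) K) =
      Module.finrank ℚ (Matrix (Fin n') (Fin n') K')) :
    Nonempty (Matrix (Fin n) (Fin n) K ≃ₐ[ℚ] Matrix (Fin n') (Fin n') K') := by
  obtain ⟨e, he⟩ := (LinearMap.injective_iff_surjective_of_finrank_eq_finrank hdim).1 hf 1
  have hmul (M X) : f (M * X) = f (M * e) * f X := by
    obtain ⟨P, hP⟩ := Matrix.exists_mul_of_forall_GL f hfs M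
    rw [hP, hP, he, mul_one]
  let φ : Matrix (Fin n) (Fin n) K →ₐ[ℚ] Matrix (Fin n') (Fin n') K' :=
    AlgHom.ofLinearMap (f ∘ₗ LinearMap.mulRight ℚ e) (by simp [he]) fun M M' => by
      simp only [LinearMap.comp_apply, LinearMap.mulRight_apply]
      rw [mul_assoc, hmul]
  have hφ : Function.Injective φ := by
    rw [injective_iff_map_eq_zero]
    intro M hM
    have h1 : f (M * 1) = f (M * e) * f 1 := hmul M 1
    have h2 : f (M * e) = 0 := hM
    rw [h2, zero_mul, mul_one] at h1
    exact (injective_iff_map_eq_zero f).1 hf M h1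
  exact ⟨AlgEquiv.ofBijective φ ⟨hφ,
    (LinearMap.injective_iff_surjective_of_finrank_eq_finrank (f := φ.toLinearMap) hdim).1 hφ⟩⟩

/-- A field is isomorphic to the center of a matrix ring over it. -/
noncomputable def Matrix.ringEquivCenter (K : Type u) [Field K] (hn : 0 < n) :
    K ≃+* Subring.center (Matrix (Fin n) (Fin n) K) :=
  RingEquiv.ofBijective ((Matrix.scalar (Fin n)).codRestrict _ fun c => by
    rw [Matrix.subringCenter_eq_scalar_map]
    exact ⟨c, by simp, rfl⟩) ⟨fun a b h => by
      have : Nonempty (Fin n) := ⟨⟨0, hn⟩⟩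
      exact Matrix.scalar_inj.1 (congrArg Subtype.val h), fun x => by
      obtain ⟨x, hx⟩ := x
      have hx' := hx
      rw [Matrix.subringCenter_eq_scalar_map] at hx'
      obtain ⟨c, -, hc⟩ := hx'
      exact ⟨c, Subtype.ext hc⟩⟩

theorem Matrix.eq_and_nonempty_ringEquiv (hn : 0 < n) (hn' : 0 < n')
    (e : Matrix (Fin n) (Fin n) K ≃ₐ[ℚ] Matrix (Fin n') (Fin n') K') :
    n = n' ∧ Nonempty (K ≃+* K') := by
  let ε : K ≃+* K' := (Matrix.ringEquivCenter K hn).trans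
    ((Subring.centerCongr e.toRingEquiv).trans (Matrix.ringEquivCenter K' hn').symm)
  refine ⟨?_, ⟨ε⟩⟩
  have h1 := e.toLinearEquiv.finrank_eq
  have h2 := ε.toRatAlgEquiv.toLinearEquiv.finrank_eq
  rw [Module.finrank_matrix, Module.finrank_matrix, ← h2, Fintype.card_fin, Fintype.card_fin] at h1
  exact Nat.mul_self_inj.1 (Nat.eq_of_mul_eq_mul_right Module.finrank_pos h1)

end MatrixAlgebras

/-! ### Isomorphic groupoids have isomorphic matrix algebras -/

theorem Globalization.nonempty_algEquiv_of_iso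
    {K : Type u} [Field K] [NumberField K] {n : ℕ} {A : Type v} [AddCommGroup A]
    {σ : AlgebraicAction (leftRegular (Matrix (Fin n) (Fin n) (𝓞 K))) A}
    {γ : Globalization σ (GL (Fin n) K) (Matrix (Fin n) (Fin n) K)} {I : Ideal (𝓞 K)}
    {K' : Type w} [Field K'] [NumberField K'] {n' : ℕ} {A' : Type x} [AddCommGroup A']
    {σ' : AlgebraicAction (leftRegular (Matrix (Fin n') (Fin n') (𝓞 K'))) A'}
    {γ' : Globalization σ' (GL (Fin n') K') (Matrix (Fin n') (Fin n') K')} {I' : Ideal (𝓞 K')}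
    (hγ : γ.IsMatrixLattice I) (hγ' : γ'.IsMatrixLattice I')
    (Φ : TopGroupoid.Iso γ.groupoid γ'.groupoid) :
    Nonempty (Matrix (Fin n) (Fin n) K ≃ₐ[ℚ] Matrix (Fin n') (Fin n') K') := by
  obtain ⟨f, hf, hfs⟩ := (OrbitCocycle.ofIso Φ).exists_linearMap hγ hγ'
  -- Only the injectivity of the map for the inverse isomorphism is used, to bound the dimension
  -- from the other side.
  obtain ⟨f', hf', -⟩ := (OrbitCocycle.ofIso Φ.symm).exists_linearMap hγ' hγ
  exact Matrix.nonempty_algEquiv_of_linearMap f hf hfs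
    (le_antisymm (LinearMap.finrank_le_finrank_of_injective hf)
      (LinearMap.finrank_le_finrank_of_injective hf'))

/-! ### Transport along isomorphisms of globalizations -/

open AlgebraicAction Globalization

section Transport

variable {S₁ : Type u} {A₁ : Type v} [Monoid S₁] [AddCommGroup A₁] {σ₁ : AlgebraicAction S₁ A₁}
  {T₁ : Type w} {B₁ : Type x} [Group T₁] [AddCommGroup B₁]
  {S₂ : Type u'} {A₂ : Type v'} [Monoid S₂] [AddCommGroup A₂] {σ₂ : AlgebraicAction S₂ A₂}
  {T₂ : Type w'} {B₂ : Type x'} [Group T₂] [AddCommGroup B₂]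

/-- An isomorphism of globalizations. -/
structure GlobalizationEquiv (γ₁ : Globalization σ₁ T₁ B₁) (γ₂ : Globalization σ₂ T₂ B₂) where
  base : A₁ ≃+ A₂
  grp : T₁ ≃* T₂
  amb : B₁ ≃+ B₂
  exists_right : ∀ s₁, ∃ s₂, ∀ a, base (σ₁.toEnd s₁ a) = σ₂.toEnd s₂ (base a)
  exists_left : ∀ s₂, ∃ s₁, ∀ a, base (σ₁.toEnd s₁ a) = σ₂.toEnd s₂ (base a)
  amb_act : ∀ t b, amb (γ₁.act t b) = γ₂.act (grp t) (amb b)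
  amb_j : ∀ a, amb (γ₁.j a) = γ₂.j (base a)

namespace GlobalizationEquiv

variable {γ₁ : Globalization σ₁ T₁ B₁} {γ₂ : Globalization σ₂ T₂ B₂}

/-- The inverse of an isomorphism of globalizations. -/
def symm (ε : GlobalizationEquiv γ₁ γ₂) : GlobalizationEquiv γ₂ γ₁ where
  base := ε.base.symm
  grp := ε.grp.symm
  amb := ε.amb.symm
  exists_right s₂ := by
    obtain ⟨s₁, h⟩ := ε.exists_left s₂
    exact ⟨s₁, fun a => by rw [AddEquiv.symm_apply_eq, h, AddEquiv.apply_symm_apply]⟩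
  exists_left s₁ := by
    obtain ⟨s₂, h⟩ := ε.exists_right s₁
    exact ⟨s₂, fun a => by rw [AddEquiv.symm_apply_eq, h, AddEquiv.apply_symm_apply]⟩
  amb_act t b := by
    rw [AddEquiv.symm_apply_eq, ε.amb_act, AddEquiv.apply_symm_apply, MulEquiv.apply_symm_apply]
  amb_j a := by rw [AddEquiv.symm_apply_eq, ε.amb_j, AddEquiv.apply_symm_apply]

variable (ε : GlobalizationEquiv γ₁ γ₂)

/-- Since `base` is bijective and matches the endomorphisms in both directions, pulling back
commutes with their images and preimages. -/
theorem isConstructible_comap {C : AddSubgroup A₂} (hC : σ₂.IsConstructible C) :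
    σ₁.IsConstructible (C.comap ε.base.toAddMonoidHom) := by
  induction hC with
  | top => exact .top
  | @map s₂ C _ ih =>
    obtain ⟨s₁, h⟩ := ε.exists_left s₂
    have h1 : (C.map (σ₂.toEnd s₂)).comap ε.base.toAddMonoidHom =
        (C.comap ε.base.toAddMonoidHom).map (σ₁.toEnd s₁) := by
      ext a
      constructor
      · rintro ⟨c, hc, hca⟩
        obtain ⟨b, rfl⟩ := ε.base.surjective c
        exact ⟨b, hc, ε.base.injective ((h b).trans hca)⟩
      · rintro ⟨b, hb, rfl⟩
        exact ⟨ε.base b, hb, (h b).symm⟩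
    rw [h1]
    exact .map s₁ ih
  | @comap s₂ C _ ih =>
    obtain ⟨s₁, h⟩ := ε.exists_left s₂
    have h1 : (C.comap (σ₂.toEnd s₂)).comap ε.base.toAddMonoidHom =
        (C.comap ε.base.toAddMonoidHom).comap (σ₁.toEnd s₁) := by
      ext a
      exact iff_of_eq (congrArg (· ∈ C) (h a).symm)
    rw [h1]
    exact .comap s₁ ih

/-- The preimage of a constructible subgroup. -/
def comapConstr (D : σ₂.Constr) : σ₁.Constr :=
  ⟨D.1.comap ε.base.toAddMonoidHom, ε.isConstructible_comap D.2⟩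

/-- The map of completions induced by an isomorphism of globalizations. -/
def completionMap (x : σ₁.Completion) : σ₂.Completion :=
  ⟨fun D => QuotientAddGroup.map (ε.comapConstr D).1 D.1 ε.base.toAddMonoidHom le_rfl
    (x.1 (ε.comapConstr D)), fun C D h => by
    obtain ⟨a, ha⟩ := x.exists_rep (ε.comapConstr C)
    beta_reduce
    rw [← ha, ← x.eq_of_le (D := ε.comapConstr D) (AddSubgroup.comap_mono h) ha]
    rfl⟩

theorem completionMap_apply {x : σ₁.Completion} {D : σ₂.Constr} {a : A₁}
    (ha : (a : A₁ ⧸ (ε.comapConstr D).1) = x.1 (ε.comapConstr D)) :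
    (ε.base a : A₂ ⧸ D.1) = (ε.completionMap x).1 D := by
  change _ = QuotientAddGroup.map (ε.comapConstr D).1 D.1 ε.base.toAddMonoidHom le_rfl _
  rw [← ha]
  rfl

theorem symm_completionMap (x : σ₁.Completion) :
    ε.symm.completionMap (ε.completionMap x) = x := by
  refine Subtype.ext (funext fun C => ?_)
  obtain ⟨a, ha⟩ := x.exists_rep C
  -- Pulling `C` back and forth gives the same subgroup only up to a propositional equality; the
  -- inclusion suffices to compare classes.
  have h : C.1 ≤ (ε.comapConstr (ε.symm.comapConstr C)).1 := fun c hc => by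
    change ε.base.symm (ε.base c) ∈ C.1
    rwa [AddEquiv.symm_apply_apply]
  rw [← ε.symm.completionMap_apply (ε.completionMap_apply (x.eq_of_le h ha)), ← ha]
  exact congrArg _ (ε.base.symm_apply_apply a)

theorem continuous_completionMap : Continuous ε.completionMap := by
  rw [continuous_iff_continuousAt]
  intro x U hU
  obtain ⟨D, hD⟩ := Completion.exists_cylinder hU
  refine Filter.mem_map.2 <| Filter.mem_of_superset ((Completion.isOpen_cylinder (ε.comapConstr D)
    {x.1 (ε.comapConstr D)}).mem_nhds rfl) fun y hy => hD _ ?_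
  exact congrArg (QuotientAddGroup.map (ε.comapConstr D).1 D.1 ε.base.toAddMonoidHom le_rfl) hy

/-- The homeomorphism of completions induced by an isomorphism of globalizations. -/
def completionHomeo : σ₁.Completion ≃ₜ σ₂.Completion where
  toFun := ε.completionMap
  invFun := ε.symm.completionMap
  left_inv := ε.symm_completionMap
  right_inv := ε.symm.symm_completionMap
  continuous_toFun := ε.continuous_completionMap
  continuous_invFun := ε.symm.continuous_completionMap

/-- The isomorphism of affine groups induced by an isomorphism of globalizations. -/
def affineEquiv : γ₁.AffineGroup ≃* γ₂.AffineGroup :=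
  SemidirectProduct.congr (AddEquiv.toMultiplicative ε.amb) ε.grp fun t =>
    MulEquiv.ext fun b => congrArg Multiplicative.ofAdd (ε.amb_act t b.toAdd)

theorem affine_affineEquiv (g : γ₁.AffineGroup) (b : B₁) :
    γ₂.affine (ε.affineEquiv g) (ε.amb b) = ε.amb (γ₁.affine g b) := by
  rw [affine, affine, map_add, ε.amb_act]
  rfl

theorem graph_completionMap {g : γ₁.AffineGroup} {x y : σ₁.Completion} (h : (x, y) ∈ γ₁.graph g) :
    (ε.completionMap x, ε.completionMap y) ∈ γ₂.graph (ε.affineEquiv g) := by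
  refine mem_graph_iff.2 fun D => ?_
  obtain ⟨a, b, hab, ha, hb⟩ := mem_graph_iff.1 h (ε.comapConstr D)
  refine ⟨ε.base a, ε.base b, ?_, ε.completionMap_apply ha, ε.completionMap_apply hb⟩
  rw [← ε.amb_j, ← ε.amb_j, affine_affineEquiv, hab]

/-- The map of arrows induced by an isomorphism of globalizations. -/
def arrowMap (p : γ₁.groupoid.Arr) : γ₂.groupoid.Arr :=
  ⟨(ε.affineEquiv p.1.1, ε.completionMap p.1.2),
    ⟨_, ε.graph_completionMap (extend_mem_graph p.2)⟩⟩

theorem continuous_arrowMap : Continuous ε.arrowMap := by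
  let : TopologicalSpace γ₁.AffineGroup := ⊥
  let : TopologicalSpace γ₂.AffineGroup := ⊥
  have : DiscreteTopology γ₁.AffineGroup := discreteTopology_bot _
  have h1 : Continuous fun p : γ₁.partialAction.Arrow => p.1 := continuous_subtype_val
  have h2 : Continuous fun p : γ₁.partialAction.Arrow =>
      (ε.affineEquiv p.1.1, ε.completionMap p.1.2) :=
    ((continuous_of_discreteTopology (f := ε.affineEquiv)).comp (continuous_fst.comp h1)).prodMk
      (ε.continuous_completionMap.comp (continuous_snd.comp h1))
  exact continuous_induced_rng.2 h2

theorem symm_arrowMap (p : γ₁.groupoid.Arr) : ε.symm.arrowMap (ε.arrowMap p) = p :=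
  Subtype.ext (Prod.ext (ε.affineEquiv.symm_apply_apply p.1.1) (ε.symm_completionMap p.1.2))

/-- The isomorphism of groupoids induced by an isomorphism of globalizations. -/
def groupoidIso : TopGroupoid.Iso γ₁.groupoid γ₂.groupoid where
  obj := ε.completionHomeo
  arr :=
    { toFun := ε.arrowMap
      invFun := ε.symm.arrowMap
      left_inv := ε.symm_arrowMap
      right_inv := ε.symm.symm_arrowMap
      continuous_toFun := ε.continuous_arrowMap
      continuous_invFun := ε.symm.continuous_arrowMap }
  map_src _ := rfl
  map_tgt p := extend_eq (ε.graph_completionMap (extend_mem_graph p.2))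
  map_comp p q _ := Subtype.ext (Prod.ext (map_mul ε.affineEquiv p.1.1 q.1.1) rfl)

end GlobalizationEquiv

end Transport

/-! ### Field isomorphisms induce groupoid isomorphisms -/

section MatrixTransport

open NumberField

variable {K : Type u} [Field K] [NumberField K] {K' : Type u'} [Field K'] [NumberField K']

theorem map_mem_leftRegular {R R' : Type*} [Ring R] [Ring R'] (e : R ≃+* R') {a : R}
    (ha : a ∈ leftRegular R) : e a ∈ leftRegular R' := fun x y h => by
  have h1 : e a * x = e a * y := h
  apply e.symm.injective
  apply ha
  apply e.injective
  simpa using h1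

/-- An isomorphism of number fields induces an isomorphism of the globalizations of the
multiplication actions of matrix rings. -/
noncomputable def matrixGlobalizationEquiv (e : K ≃+* K') (n : ℕ) :
    GlobalizationEquiv (matrixGlobalization K n) (matrixGlobalization K' n) where
  base := (RingOfIntegers.mapRingEquiv e).mapMatrix.toAddEquiv
  grp := Units.mapEquiv e.mapMatrix.toMulEquiv
  amb := e.mapMatrix.toAddEquiv
  exists_right s := ⟨⟨(RingOfIntegers.mapRingEquiv e).mapMatrix s.1,
    map_mem_leftRegular (RingOfIntegers.mapRingEquiv e).mapMatrix s.2⟩,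
    fun a => map_mul (RingOfIntegers.mapRingEquiv e).mapMatrix s.1 a⟩
  exists_left s := ⟨⟨(RingOfIntegers.mapRingEquiv e).mapMatrix.symm s.1,
    map_mem_leftRegular (RingOfIntegers.mapRingEquiv e).mapMatrix.symm s.2⟩,
    fun a => (map_mul (RingOfIntegers.mapRingEquiv e).mapMatrix _ a).trans
      (congrArg (· * _) (RingEquiv.apply_symm_apply _ s.1))⟩
  amb_act t b := map_mul e.mapMatrix t.1 b
  amb_j _ := rfl

end MatrixTransport

theorem mainTheorem8
    (K₁ : Type u) [Field K₁] [NumberField K₁] (K₂ : Type v) [Field K₂] [NumberField K₂]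
    (n₁ n₂ : ℕ) (hn₁ : 0 < n₁) (hn₂ : 0 < n₂) :
    (Nonempty (TopGroupoid.Iso (matrixGroupoid K₁ n₁) (matrixGroupoid K₂ n₂)) ↔
      n₁ = n₂ ∧ Nonempty (K₁ ≃+* K₂)) ∧
    (∀ (I₁ : Ideal (NumberField.RingOfIntegers K₁)) (I₂ : Ideal (NumberField.RingOfIntegers K₂))
      (hI₁ : I₁ ≠ ⊥) (hI₂ : I₂ ≠ ⊥),
      Nonempty (TopGroupoid.Iso (matrixIdealGroupoid K₁ n₁ I₁ hI₁)
        (matrixIdealGroupoid K₂ n₂ I₂ hI₂)) →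
      Nonempty (Matrix (Fin n₁) (Fin n₁) K₁ ≃ₐ[ℚ] Matrix (Fin n₂) (Fin n₂) K₂)) := by
  refine ⟨⟨?_, ?_⟩, ?_⟩
  · rintro ⟨Φ⟩
    obtain ⟨e⟩ := Globalization.nonempty_algEquiv_of_iso
      (isMatrixLattice_matrixGlobalization K₁ n₁) (isMatrixLattice_matrixGlobalization K₂ n₂) Φ
    exact Matrix.eq_and_nonempty_ringEquiv hn₁ hn₂ e
  · rintro ⟨rfl, ⟨e⟩⟩
    exact ⟨(matrixGlobalizationEquiv e n₁).groupoidIso⟩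
  · rintro I₁ I₂ hI₁ hI₂ ⟨Φ⟩
    exact Globalization.nonempty_algEquiv_of_iso
      (isMatrixLattice_matrixIdealGlobalization K₁ n₁ I₁ hI₁)
      (isMatrixLattice_matrixIdealGlobalization K₂ n₂ I₂ hI₂) Φ
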